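/- For a positive integer $n$ let $M_n$ be the set of $n\times n$ complex matrices, and for $A\in M_n$ let $$W(A)=\{u^*Au : u\in\mathbb C^n,\ u^*u=1\},\qquad w(A)=\sup\{|\mu| : \mu\in W(A)\}$$ be its numerical range and numerical radius. Let $m\ge 1$, let $n_1,\dots,n_m\ge 2$ be integers and $N=\prod_{j=1}^m n_j$. Here $A_1\otimes\cdots\otimes A_m\in M_N$ denotes the tensor (Kronecker) product of $A_1\in M_{n_1},\dots,A_m\in M_{n_m}$, the rows and columns of matrices in $M_N$ being labelled by multi-indices $(i_1,\dots,i_m)$ with $1\le i_k\le n_k$. The following are equivalent for a linear map $\phi: M_N\to M_N$. (a) $w(\phi(A_1\otimes\cdots\otimes A_m)) = w(A_1\otimes\cdots\otimes A_m)$ for all $(A_1,\dots,A_m)\in M_{n_1}\times\cdots\times M_{n_m}$. (b) There are a unitary matrix $U\in M_N$, a complex number $\xi$ with $|\xi|=1$, and maps $\varphi_k: M_{n_k}\to M_{n_k}$ $(k=1,\dots,m)$, each of which is the identity map or the transposition map $X\mapsto X^t$, such that $$\phi(A_1\otimes\cdots\otimes A_m)=\xi\, U\bigl(\varphi_1(A_1)\otimes\cdots\otimes\varphi_m(A_m)\bigr)U^*$$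 for all $(A_1,\dots,A_m)\in M_{n_1}\times\cdots\times M_{n_m}$, and the maps $\varphi_j$ with $n_j\ge 3$ are of the same type, i.e. either all of them are the identity or all of them are the transposition. -/

import Mathlib

open scoped Matrix

/-- The numerical range `W(A) = {u* A u : u* u = 1}` of a square complex matrix. -/
def numericalRange {ι : Type*} [Fintype ι] (A : Matrix ι ι ℂ) : Set ℂ :=
  {z | ∃ u : ι → ℂ, star u ⬝ᵥ u = 1 ∧ star u ⬝ᵥ (A *ᵥ u) = z}

/-- The numerical radius `w(A) = sup {|μ| : μ ∈ W(A)}` of a square complex matrix. -/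
noncomputable def numericalRadius {ι : Type*} [Fintype ι] (A : Matrix ι ι ℂ) : ℝ :=
  sSup ((fun μ : ℂ => ‖μ‖) '' numericalRange A)

/-- The index set of the rows and columns of the matrices in `M_N`, `N = n₁ ⋯ n_m`:
the multi-indices `(i₁, …, i_m)` with `i_k` ranging over `n_k` values. -/
abbrev MultiIndex {m : ℕ} (n : Fin m → ℕ) : Type := ∀ k : Fin m, Fin (n k)

/-- The tensor (Kronecker) product `A₁ ⊗ ⋯ ⊗ A_m`: its entry at row `(i₁, …, i_m)` and
column `(j₁, …, j_m)` is the product of the entries `(A_k)_{i_k j_k}`. -/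
def tensorMatrix {m : ℕ} {n : Fin m → ℕ} (A : ∀ k : Fin m, Matrix (Fin (n k)) (Fin (n k)) ℂ) :
    Matrix (MultiIndex n) (MultiIndex n) ℂ :=
  Matrix.of fun i j => ∏ k, A k (i k) (j k)

/-! ### Numerical radius: Schur test, attainment, invariances. -/

section NumericalRadius

variable {ι : Type*} [Fintype ι]

/-! (b) implies (a): the numerical radius `w` is unchanged by unitary similarity, unimodular scalars
and transposition of the whole matrix. A `2 × 2` matrix is unitarily similar to its transpose, so
transposing a factor of size 2 is invisible to `w`; the larger factors are transposed together or
not at all.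

(a) implies (b): let `F j` be the image of the diagonal unit at `j`. Tensor products of diagonal
unitaries have radius 1, so `∑ j, c j • F j` has radius at most 1 for every product phase `c`. At a
unit vector `u i` where `F i` attains its radius 1, averaging over roots of unity forces equality
for each phase, and Fourier inversion shows that every other `F j` and its adjoint kill `u i`
(`mulVec_eq_zero_of_phases`). The `u i` are therefore orthonormal, and `φ` is a unitary conjugation
on diagonal matrices, up to phases. Comparing bases that differ in one factor shows that these
phases form one constant (`PreservesRadius.phase_update`).

The same holds for every product basis, by precomposing with local unitaries. After normalisation,
the spectral theorem and multilinearity give these facts: `φ` respects adjoints of tensor products,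
the induced map on each factor is Jordan, these maps commute for distinct factors, and they assemble
`φ` on tensor products. On a corner, with rank-one projections in the other slots, diagonal units go
to diagonal units, so the Jordan map is multiplicative or anti-multiplicative; commutation with the
other factors spreads this to the whole factor. Undoing the transposition on the remaining factors
leaves a `*`-endomorphism fixing the diagonal units, which is a unitary conjugation.

Finally, types cannot mix on factors of size at least 3. For the shift `S` with weights 1, 2, `S ⊗
S` contains a shift with weights 1, 4 and has radius above 2, while `Sᵀ ⊗ S` has radius at most 2.
-/

theorem dotProduct_star_self_eq_sum (u : ι → ℂ) :
    star u ⬝ᵥ u = ((∑ i, ‖u i‖ ^ 2 : ℝ) : ℂ) := by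
  simp only [dotProduct, Pi.star_apply, RCLike.star_def, Complex.conj_mul']
  push_cast
  rfl

theorem sum_norm_sq_eq_one {u : ι → ℂ} (hu : star u ⬝ᵥ u = 1) : ∑ i, ‖u i‖ ^ 2 = 1 := by
  rw [dotProduct_star_self_eq_sum] at hu
  exact_mod_cast hu

/-- A weighted Schur test: the quadratic form is bounded by half the sum of the row and column
sums. -/
theorem norm_quadForm_le {X : Matrix ι ι ℂ} {c : ℝ}
    (h : ∀ i, ∑ j, ‖X i j‖ + ∑ j, ‖X j i‖ ≤ 2 * c) {u : ι → ℂ} (hu : star u ⬝ᵥ u = 1) :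
    ‖star u ⬝ᵥ (X *ᵥ u)‖ ≤ c := by
  have h1 : ‖star u ⬝ᵥ (X *ᵥ u)‖ ≤ ∑ i, ∑ j, ‖X i j‖ * ((‖u i‖ ^ 2 + ‖u j‖ ^ 2) / 2) := by
    simp only [dotProduct, Matrix.mulVec, Finset.mul_sum]
    refine (norm_sum_le _ _).trans (Finset.sum_le_sum fun i _ => (norm_sum_le _ _).trans
      (Finset.sum_le_sum fun j _ => ?_))
    simp only [norm_mul, Pi.star_apply, norm_star]
    nlinarith [sq_nonneg (‖u i‖ - ‖u j‖), norm_nonneg (X i j),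
      mul_nonneg (norm_nonneg (X i j)) (sq_nonneg (‖u i‖ - ‖u j‖))]
  have h2 : ∑ i, ∑ j, ‖X i j‖ * ((‖u i‖ ^ 2 + ‖u j‖ ^ 2) / 2)
      = ∑ i, (∑ j, ‖X i j‖ + ∑ j, ‖X j i‖) * (‖u i‖ ^ 2 / 2) := by
    have h3 : ∑ i, ∑ j, ‖X i j‖ * ((‖u i‖ ^ 2 + ‖u j‖ ^ 2) / 2)
        = ∑ i, ∑ j, ‖X i j‖ * (‖u i‖ ^ 2 / 2) + ∑ i, ∑ j, ‖X i j‖ * (‖u j‖ ^ 2 / 2) := by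
      simp only [← Finset.sum_add_distrib]
      refine Finset.sum_congr rfl fun i _ => Finset.sum_congr rfl fun j _ => by ring
    rw [h3, Finset.sum_comm (f := fun i j => ‖X i j‖ * (‖u j‖ ^ 2 / 2)),
      ← Finset.sum_add_distrib]
    refine Finset.sum_congr rfl fun i _ => by rw [add_mul, Finset.sum_mul, Finset.sum_mul]
  have h4 : ∑ i, (∑ j, ‖X i j‖ + ∑ j, ‖X j i‖) * (‖u i‖ ^ 2 / 2)
      ≤ ∑ i, (2 * c) * (‖u i‖ ^ 2 / 2) :=
    Finset.sum_le_sum fun i _ => mul_le_mul_of_nonneg_right (h i) (by positivity)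
  rw [← Finset.mul_sum, ← Finset.sum_div, sum_norm_sq_eq_one hu] at h4
  linarith

theorem isCompact_unitVectors : IsCompact {u : ι → ℂ | star u ⬝ᵥ u = 1} := by
  refine Metric.isCompact_of_isClosed_isBounded
    (isClosed_eq (by simp only [dotProduct, Pi.star_apply]; fun_prop) continuous_const) ?_
  refine (Metric.isBounded_closedBall (x := (0 : ι → ℂ)) (r := 1)).subset fun u hu => ?_
  rw [mem_closedBall_zero_iff, pi_norm_le_iff_of_nonneg zero_le_one]
  intro i
  have h1 := sum_norm_sq_eq_one hu
  have h2 := Finset.single_le_sum (f := fun i => ‖u i‖ ^ 2) (fun i _ => by positivity)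
    (Finset.mem_univ i)
  nlinarith [norm_nonneg (u i)]

theorem continuous_quadForm (X : Matrix ι ι ℂ) : Continuous fun u => star u ⬝ᵥ (X *ᵥ u) := by
  simp only [dotProduct, Pi.star_apply, Matrix.mulVec]
  fun_prop

theorem image_norm_numericalRange (X : Matrix ι ι ℂ) :
    (fun μ : ℂ => ‖μ‖) '' numericalRange X =
      (fun u => ‖star u ⬝ᵥ (X *ᵥ u)‖) '' {u : ι → ℂ | star u ⬝ᵥ u = 1} := by
  ext r
  constructor
  · rintro ⟨_, ⟨u, hu, rfl⟩, rfl⟩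
    exact ⟨u, hu, rfl⟩
  · rintro ⟨u, hu, rfl⟩
    exact ⟨_, ⟨u, hu, rfl⟩, rfl⟩

theorem isCompact_image_norm_numericalRange (X : Matrix ι ι ℂ) :
    IsCompact ((fun μ : ℂ => ‖μ‖) '' numericalRange X) := by
  rw [image_norm_numericalRange]
  exact isCompact_unitVectors.image (continuous_quadForm X).norm

theorem norm_quadForm_le_numericalRadius (X : Matrix ι ι ℂ) {u : ι → ℂ} (hu : star u ⬝ᵥ u = 1) :
    ‖star u ⬝ᵥ (X *ᵥ u)‖ ≤ numericalRadius X :=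
  le_csSup (isCompact_image_norm_numericalRange X).bddAbove ⟨_, ⟨u, hu, rfl⟩, rfl⟩

theorem norm_quadForm_le_mul {X : Matrix ι ι ℂ} {c : ℝ}
    (h : ∀ u : ι → ℂ, star u ⬝ᵥ u = 1 → ‖star u ⬝ᵥ (X *ᵥ u)‖ ≤ c) (u : ι → ℂ) :
    ‖star u ⬝ᵥ (X *ᵥ u)‖ ≤ c * ∑ i, ‖u i‖ ^ 2 := by
  by_cases hu : u = 0
  · simp [hu]
  · have hpos : 0 < ∑ i, ‖u i‖ ^ 2 := by
      obtain ⟨i, hi⟩ := Function.ne_iff.1 hu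
      exact Finset.sum_pos' (fun i _ => by positivity)
        ⟨i, Finset.mem_univ i, by have := norm_pos_iff.2 hi; positivity⟩
    set r : ℝ := (√(∑ i, ‖u i‖ ^ 2))⁻¹ with hr
    have hr2 : r * r = (∑ i, ‖u i‖ ^ 2)⁻¹ := by
      rw [hr, ← mul_inv, Real.mul_self_sqrt hpos.le]
    have hsmul : ∀ v : ι → ℂ, star ((r : ℂ) • u) ⬝ᵥ ((r : ℂ) • v) =
        ((r * r : ℝ) : ℂ) * (star u ⬝ᵥ v) := fun v => by
      rw [star_smul, smul_dotProduct, dotProduct_smul]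
      simp only [RCLike.star_def, Complex.conj_ofReal, smul_eq_mul]
      push_cast
      ring
    have h1 : star ((r : ℂ) • u) ⬝ᵥ ((r : ℂ) • u) = 1 := by
      rw [hsmul, dotProduct_star_self_eq_sum, hr2]
      norm_cast
      exact inv_mul_cancel₀ hpos.ne'
    have h2 := h _ h1
    rw [Matrix.mulVec_smul, hsmul, hr2, norm_mul, Complex.norm_real, Real.norm_eq_abs,
      abs_of_pos (inv_pos.2 hpos), inv_mul_le_iff₀ hpos] at h2
    linarith

theorem star_single_dotProduct_single [DecidableEq ι] (i : ι) :
    star (Pi.single i 1 : ι → ℂ) ⬝ᵥ Pi.single i 1 = 1 := by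
  simp

theorem nonempty_image_norm_numericalRange [Nonempty ι] (X : Matrix ι ι ℂ) :
    ((fun μ : ℂ => ‖μ‖) '' numericalRange X).Nonempty := by
  classical
  exact ⟨_, _, ⟨Pi.single (Classical.arbitrary ι) 1, star_single_dotProduct_single _, rfl⟩, rfl⟩

theorem exists_norm_quadForm_eq_numericalRadius [Nonempty ι] (X : Matrix ι ι ℂ) :
    ∃ u : ι → ℂ, star u ⬝ᵥ u = 1 ∧ ‖star u ⬝ᵥ (X *ᵥ u)‖ = numericalRadius X := by
  obtain ⟨_, ⟨u, hu, rfl⟩, h⟩ := (isCompact_image_norm_numericalRange X).sSup_mem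
    (nonempty_image_norm_numericalRange X)
  exact ⟨u, hu, h⟩

theorem numericalRadius_le [Nonempty ι] {X : Matrix ι ι ℂ} {c : ℝ}
    (h : ∀ u : ι → ℂ, star u ⬝ᵥ u = 1 → ‖star u ⬝ᵥ (X *ᵥ u)‖ ≤ c) : numericalRadius X ≤ c := by
  obtain ⟨u, hu, h'⟩ := exists_norm_quadForm_eq_numericalRadius X
  exact h' ▸ h u hu

theorem numericalRange_transpose (X : Matrix ι ι ℂ) : numericalRange Xᵀ = numericalRange X := by
  have key : ∀ X : Matrix ι ι ℂ, numericalRange Xᵀ ⊆ numericalRange X := by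
    rintro X _ ⟨u, hu, rfl⟩
    refine ⟨star u, by rwa [star_star, dotProduct_comm], ?_⟩
    rw [star_star, Matrix.mulVec_transpose, dotProduct_comm (star u), Matrix.dotProduct_mulVec]
  exact (key X).antisymm (by simpa using key Xᵀ)

theorem numericalRadius_transpose (X : Matrix ι ι ℂ) : numericalRadius Xᵀ = numericalRadius X := by
  rw [numericalRadius, numericalRange_transpose, numericalRadius]

theorem numericalRange_smul {ξ : ℂ} (X : Matrix ι ι ℂ) :
    numericalRange (ξ • X) = (fun z => ξ * z) '' numericalRange X := by
  ext z
  constructor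
  · rintro ⟨u, hu, rfl⟩
    exact ⟨_, ⟨u, hu, rfl⟩, by simp [Matrix.smul_mulVec]⟩
  · rintro ⟨_, ⟨u, hu, rfl⟩, rfl⟩
    exact ⟨u, hu, by simp [Matrix.smul_mulVec]⟩

theorem numericalRadius_smul {ξ : ℂ} (hξ : ‖ξ‖ = 1) (X : Matrix ι ι ℂ) :
    numericalRadius (ξ • X) = numericalRadius X := by
  rw [numericalRadius, numericalRange_smul, Set.image_image, numericalRadius]
  simp [hξ]

variable [DecidableEq ι]

theorem numericalRange_conj_subset {U : Matrix ι ι ℂ} (hU : U ∈ Matrix.unitaryGroup ι ℂ)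
    (X : Matrix ι ι ℂ) : numericalRange (U * X * Uᴴ) ⊆ numericalRange X := by
  rintro _ ⟨u, hu, rfl⟩
  have h : ∀ v : ι → ℂ, star (Uᴴ *ᵥ u) ⬝ᵥ v = star u ⬝ᵥ (U *ᵥ v) := fun v => by
    rw [Matrix.star_mulVec, Matrix.conjTranspose_conjTranspose, Matrix.dotProduct_mulVec]
  refine ⟨Uᴴ *ᵥ u, ?_, ?_⟩
  · have := Matrix.mem_unitaryGroup_iff.1 hU
    rw [Matrix.star_eq_conjTranspose] at this
    rw [h, Matrix.mulVec_mulVec, this, Matrix.one_mulVec, hu]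
  · rw [h, Matrix.mulVec_mulVec, Matrix.mulVec_mulVec, Matrix.mul_assoc]

theorem numericalRadius_conj {U : Matrix ι ι ℂ} (hU : U ∈ Matrix.unitaryGroup ι ℂ)
    (X : Matrix ι ι ℂ) : numericalRadius (U * X * Uᴴ) = numericalRadius X := by
  rw [numericalRadius, numericalRadius,
    (numericalRange_conj_subset hU X).antisymm fun z hz => ?_]
  refine numericalRange_conj_subset (U := Uᴴ) (Unitary.star_mem hU) _ ?_
  have := Matrix.mem_unitaryGroup_iff'.1 hU
  rw [Matrix.star_eq_conjTranspose] at this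
  have e : Uᴴ * (U * X * Uᴴ) * Uᴴᴴ = X := by
    rw [Matrix.conjTranspose_conjTranspose]
    simp only [← Matrix.mul_assoc]
    rw [this, Matrix.one_mul, Matrix.mul_assoc, this, Matrix.mul_one]
  rwa [e]

/-- Complex polarisation: a vanishing quadratic form determines the zero operator. This later gives
injectivity of `φ` on a single slot. -/
theorem eq_zero_of_numericalRadius_eq_zero {X : Matrix ι ι ℂ} (h : numericalRadius X = 0) :
    X = 0 := by
  have h0 : ∀ u : ι → ℂ, star u ⬝ᵥ (X *ᵥ u) = 0 := by
    intro u
    have := norm_quadForm_le_mul (c := 0) (fun v hv => h ▸ norm_quadForm_le_numericalRadius X hv) u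
    rwa [zero_mul, norm_le_zero_iff] at this
  have h1 : X.toEuclideanLin = 0 := by
    rw [← inner_map_self_eq_zero]
    intro v
    have := h0 v.ofLp
    rw [Matrix.star_dotProduct, star_eq_zero] at this
    rw [EuclideanSpace.inner_eq_star_dotProduct, dotProduct_comm]
    simpa [Matrix.toLpLin_apply] using this
  simpa using h1

end NumericalRadius

/-! ### Algebra of tensor products of matrices. -/

section Tensor

variable {m : ℕ} {n : Fin m → ℕ}

theorem tensorMatrix_apply (A : ∀ k, Matrix (Fin (n k)) (Fin (n k)) ℂ) (i j : MultiIndex n) :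
    tensorMatrix A i j = ∏ k, A k (i k) (j k) := rfl

theorem tensorMatrix_mul (A B : ∀ k, Matrix (Fin (n k)) (Fin (n k)) ℂ) :
    tensorMatrix A * tensorMatrix B = tensorMatrix fun k => A k * B k := by
  ext i j
  simp only [Matrix.mul_apply, tensorMatrix_apply, ← Finset.prod_mul_distrib]
  rw [Finset.prod_univ_sum, Fintype.piFinset_univ]

theorem tensorMatrix_conjTranspose (A : ∀ k, Matrix (Fin (n k)) (Fin (n k)) ℂ) :
    (tensorMatrix A)ᴴ = tensorMatrix fun k => (A k)ᴴ := by
  ext i j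
  simp [tensorMatrix_apply, Matrix.conjTranspose_apply]

theorem tensorMatrix_transpose (A : ∀ k, Matrix (Fin (n k)) (Fin (n k)) ℂ) :
    (tensorMatrix A)ᵀ = tensorMatrix fun k => (A k)ᵀ := rfl

theorem tensorMatrix_diagonal (d : ∀ k, Fin (n k) → ℂ) :
    tensorMatrix (fun k => Matrix.diagonal (d k)) =
      Matrix.diagonal fun i : MultiIndex n => ∏ k, d k (i k) := by
  ext i j
  rw [tensorMatrix_apply]
  by_cases h : i = j
  · subst h
    simp
  · rw [Matrix.diagonal_apply_ne _ h]
    obtain ⟨k, hk⟩ := Function.ne_iff.1 h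
    exact Finset.prod_eq_zero (Finset.mem_univ k) (Matrix.diagonal_apply_ne _ hk)

theorem tensorMatrix_one : tensorMatrix (fun k => (1 : Matrix (Fin (n k)) (Fin (n k)) ℂ)) = 1 := by
  simpa [Matrix.diagonal_one] using tensorMatrix_diagonal (n := n) fun k _ => 1

theorem tensorMatrix_single (i j : MultiIndex n) :
    tensorMatrix (fun k => Matrix.single (i k) (j k) (1 : ℂ)) = Matrix.single i j 1 := by
  ext p q
  rw [tensorMatrix_apply]
  simp only [Matrix.single_apply]
  rw [Finset.prod_ite_zero]
  simp [funext_iff, forall_and]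

theorem tensorMatrix_mem_unitaryGroup {V : ∀ k, Matrix (Fin (n k)) (Fin (n k)) ℂ}
    (hV : ∀ k, V k ∈ Matrix.unitaryGroup (Fin (n k)) ℂ) :
    tensorMatrix V ∈ Matrix.unitaryGroup (MultiIndex n) ℂ := by
  rw [Matrix.mem_unitaryGroup_iff, Matrix.star_eq_conjTranspose, tensorMatrix_conjTranspose,
    tensorMatrix_mul, ← tensorMatrix_one]
  congr 1
  funext k
  exact Matrix.mem_unitaryGroup_iff.1 (hV k)

theorem tensorMatrix_conj (V A : ∀ k, Matrix (Fin (n k)) (Fin (n k)) ℂ) :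
    tensorMatrix V * tensorMatrix A * (tensorMatrix V)ᴴ =
      tensorMatrix fun k => V k * A k * (V k)ᴴ := by
  rw [tensorMatrix_conjTranspose, tensorMatrix_mul, tensorMatrix_mul]

theorem tensorMatrix_update_apply (A : ∀ k, Matrix (Fin (n k)) (Fin (n k)) ℂ) (k : Fin m)
    (X : Matrix (Fin (n k)) (Fin (n k)) ℂ) (i j : MultiIndex n) :
    tensorMatrix (Function.update A k X) i j =
      X (i k) (j k) * ∏ l ∈ Finset.univ.erase k, A l (i l) (j l) := by
  rw [tensorMatrix_apply, ← Finset.mul_prod_erase _ _ (Finset.mem_univ k), Function.update_self]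
  congr 1
  refine Finset.prod_congr rfl fun l hl => ?_
  rw [Function.update_of_ne (Finset.ne_of_mem_erase hl)]

/-- The tensor product as a linear map in its `k`-th factor. -/
def tensorSlot (A : ∀ k, Matrix (Fin (n k)) (Fin (n k)) ℂ) (k : Fin m) :
    Matrix (Fin (n k)) (Fin (n k)) ℂ →ₗ[ℂ] Matrix (MultiIndex n) (MultiIndex n) ℂ where
  toFun X := tensorMatrix (Function.update A k X)
  map_add' X Y := by
    ext i j
    simp [tensorMatrix_update_apply, add_mul]
  map_smul' c X := by
    ext i j
    simp [tensorMatrix_update_apply, mul_assoc]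

theorem tensorSlot_apply (A : ∀ k, Matrix (Fin (n k)) (Fin (n k)) ℂ) (k : Fin m)
    (X : Matrix (Fin (n k)) (Fin (n k)) ℂ) :
    tensorSlot A k X = tensorMatrix (Function.update A k X) := rfl

theorem sum_norm_tensorMatrix_row (A : ∀ k, Matrix (Fin (n k)) (Fin (n k)) ℂ) (i : MultiIndex n) :
    ∑ j, ‖tensorMatrix A i j‖ = ∏ k, ∑ b, ‖A k (i k) b‖ := by
  simp only [tensorMatrix_apply, norm_prod]
  rw [Finset.prod_univ_sum, Fintype.piFinset_univ]

theorem sum_norm_tensorMatrix_col (A : ∀ k, Matrix (Fin (n k)) (Fin (n k)) ℂ) (i : MultiIndex n) :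
    ∑ j, ‖tensorMatrix A j i‖ = ∏ k, ∑ b, ‖A k b (i k)‖ := by
  simp only [tensorMatrix_apply, norm_prod]
  rw [Finset.prod_univ_sum, Fintype.piFinset_univ]

end Tensor

/-! ### Transposition in size two. -/

section UnitarilySimilarToTranspose

/-- A real-linear map from a space of real dimension 3 to one of dimension 2 has a kernel. -/
theorem exists_ne_zero_trace_eq_zero (a b c : ℂ) :
    ∃ (x : ℝ) (z : ℂ), (x, z) ≠ 0 ∧ x * a + z * b + star z * c = 0 := by
  let L : ℝ × ℂ →ₗ[ℝ] ℂ :=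
    { toFun := fun p => p.1 * a + p.2 * b + star p.2 * c
      map_add' := fun p q => by simp; ring
      map_smul' := fun r p => by simp; ring }
  have h : LinearMap.ker L ≠ ⊥ := LinearMap.ker_ne_bot_of_finrank_lt (by simp)
  obtain ⟨p, hp, hp0⟩ := (Submodule.ne_bot_iff _).1 h
  exact ⟨p.1, p.2, hp0, hp⟩

/-- A `2 × 2` complex matrix is unitarily similar to its transpose. -/
theorem exists_unitary_conj_eq_transpose_fin_two (A : Matrix (Fin 2) (Fin 2) ℂ) :
    ∃ V ∈ Matrix.unitaryGroup (Fin 2) ℂ, Aᵀ = V * A * Vᴴ := by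
  obtain ⟨x, z, hxz, h⟩ := exists_ne_zero_trace_eq_zero (A 0 0 - A 1 1) (A 1 0) (A 0 1)
  have hpos : 0 < x ^ 2 + ‖z‖ ^ 2 := by
    by_contra hcon
    have hx : x = 0 := by nlinarith [sq_nonneg x, sq_nonneg ‖z‖]
    have hz : ‖z‖ = 0 := by nlinarith [sq_nonneg x, sq_nonneg ‖z‖]
    exact hxz (by simp [hx, norm_eq_zero.1 hz])
  set r : ℝ := (√(x ^ 2 + ‖z‖ ^ 2))⁻¹ with hr
  have hr2 : (r : ℂ) ^ 2 * (x ^ 2 + z * star z) = 1 := by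
    rw [RCLike.star_def, Complex.mul_conj']
    norm_cast
    rw [hr, inv_pow, Real.sq_sqrt hpos.le, inv_mul_cancel₀ hpos.ne']
  -- `V` is symmetric, so `Aᵀ * V = V * A` says that `V * A` is symmetric. That is one complex
  -- equation, the one solved by `x` and `z`; `r` normalises `V` to be unitary.
  let V : Matrix (Fin 2) (Fin 2) ℂ := !![r * star z, -(r * x); -(r * x), -(r * z)]
  have hVH : Vᴴ = !![r * z, -(r * x); -(r * x), -(r * star z)] := by
    ext i j
    fin_cases i <;> fin_cases j <;> simp [V, Matrix.conjTranspose_apply]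
  have hV : V * Vᴴ = 1 := by
    rw [hVH]
    ext i j
    fin_cases i <;> fin_cases j <;> simp [V, Matrix.mul_apply, Fin.sum_univ_two] <;>
      simp at hr2 <;> first | ring1 | linear_combination hr2
  have hVA : Aᵀ * V = V * A := by
    ext i j
    fin_cases i <;> fin_cases j <;> simp [V, Matrix.mul_apply, Fin.sum_univ_two] <;>
      simp at h <;> first | ring1 | linear_combination (r : ℂ) * h | linear_combination -(r : ℂ) * h
  refine ⟨V, Matrix.mem_unitaryGroup_iff.2 hV, ?_⟩
  rw [← hVA, Matrix.mul_assoc, hV, Matrix.mul_one]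

theorem exists_unitary_conj_eq_transpose {N : ℕ} (hN : N = 2) (A : Matrix (Fin N) (Fin N) ℂ) :
    ∃ V ∈ Matrix.unitaryGroup (Fin N) ℂ, Aᵀ = V * A * Vᴴ := by
  subst hN
  exact exists_unitary_conj_eq_transpose_fin_two A

end UnitarilySimilarToTranspose

/-! ### The listed maps preserve the numerical radius. -/

section Sufficiency

variable {m : ℕ} {n : Fin m → ℕ}

/-- The local unitaries may depend on `A`, as they do for transposes in size 2, since only radii are
compared. -/
theorem numericalRadius_tensorMatrix_congr {A B : ∀ k, Matrix (Fin (n k)) (Fin (n k)) ℂ}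
    (h : ∀ k, ∃ V ∈ Matrix.unitaryGroup (Fin (n k)) ℂ, B k = V * A k * Vᴴ) :
    numericalRadius (tensorMatrix B) = numericalRadius (tensorMatrix A) := by
  choose V hV hB using h
  rw [show B = fun k => V k * A k * (V k)ᴴ from funext hB, ← tensorMatrix_conj,
    numericalRadius_conj (tensorMatrix_mem_unitaryGroup hV)]

theorem numericalRadius_tensorMatrix_transposition (hn : ∀ k, 2 ≤ n k)
    {f : ∀ k : Fin m, Matrix (Fin (n k)) (Fin (n k)) ℂ → Matrix (Fin (n k)) (Fin (n k)) ℂ}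
    (hf : ∀ k, f k = id ∨ f k = Matrix.transpose)
    (hf3 : (∀ k, 3 ≤ n k → f k = id) ∨ (∀ k, 3 ≤ n k → f k = Matrix.transpose))
    (A : ∀ k, Matrix (Fin (n k)) (Fin (n k)) ℂ) :
    numericalRadius (tensorMatrix fun k => f k (A k)) = numericalRadius (tensorMatrix A) := by
  have hid : ∀ k (X : Matrix (Fin (n k)) (Fin (n k)) ℂ),
      ∃ V ∈ Matrix.unitaryGroup (Fin (n k)) ℂ, X = V * X * Vᴴ :=
    fun k X => ⟨1, one_mem _, by simp⟩
  rcases hf3 with h3 | h3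
  · refine numericalRadius_tensorMatrix_congr fun k => ?_
    rcases (hn k).eq_or_lt with hk | hk
    · rcases hf k with h | h
      · rw [h]; exact hid k _
      · rw [h]; exact exists_unitary_conj_eq_transpose hk.symm _
    · rw [h3 k hk]; exact hid k _
  -- Compare with the fully transposed product: only factors of size 2 on which `f k = id` then
  -- differ, again by a unitary similarity.
  · rw [← numericalRadius_transpose (tensorMatrix A), tensorMatrix_transpose]
    refine numericalRadius_tensorMatrix_congr fun k => ?_
    rcases (hn k).eq_or_lt with hk | hk
    · rcases hf k with h | h
      · rw [h]
        simpa using exists_unitary_conj_eq_transpose hk.symm (A k)ᵀ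
      · rw [h]; exact hid k _
    · rw [h3 k hk]; exact hid k _

end Sufficiency

/-! ### Orthogonality of characters. -/

section RootsOfUnity

theorem sum_zpow_pow_eq_zero {M : ℕ} {ζ : ℂ} (hζ : IsPrimitiveRoot ζ M) {e : ℤ}
    (he : ¬ (M : ℤ) ∣ e) : ∑ t ∈ Finset.range M, (ζ ^ e) ^ t = 0 := by
  have h1 : ζ ^ e - 1 ≠ 0 := fun h => he ((hζ.zpow_eq_one_iff_dvd e).1 (sub_eq_zero.1 h))
  have h2 : (ζ ^ e) ^ M = 1 := by
    rw [← zpow_natCast, ← zpow_mul, mul_comm, zpow_mul, zpow_natCast, hζ.pow_eq_one, one_zpow]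
  have h3 := mul_geom_sum (ζ ^ e) M
  rw [h2, sub_self] at h3
  exact (mul_eq_zero.1 h3).resolve_left h1

theorem star_eq_inv_of_norm_eq_one {z : ℂ} (hz : ‖z‖ = 1) : star z = z⁻¹ := by
  rw [Complex.inv_def, Complex.normSq_eq_norm_sq, hz]
  simp

theorem sum_star_phase_mul_phase {M : ℕ} {ζ : ℂ} (hζ : IsPrimitiveRoot ζ M) (hζ1 : ‖ζ‖ = 1)
    {a b : ℕ} (ha : a < M) (hb : b < M) (hab : a ≠ b) :
    ∑ t ∈ Finset.range M, star ((ζ ^ a) ^ t) * (ζ ^ b) ^ t = 0 := by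
  have h0 : ζ ≠ 0 := by rintro rfl; simp at hζ1
  rw [← sum_zpow_pow_eq_zero hζ (e := (b : ℤ) - a) fun h => ?_]
  · refine Finset.sum_congr rfl fun t _ => ?_
    rw [star_pow, star_pow, star_eq_inv_of_norm_eq_one hζ1, ← mul_pow, zpow_sub₀ h0,
      zpow_natCast, zpow_natCast, inv_pow, div_eq_inv_mul]
  · have := Int.eq_zero_of_abs_lt_dvd h (by rw [abs_lt]; omega)
    omega

theorem sum_phase_mul_phase {M : ℕ} {ζ : ℂ} (hζ : IsPrimitiveRoot ζ M)
    {a b : ℕ} (h0 : 0 < a + b) (hab : a + b < M) :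
    ∑ t ∈ Finset.range M, (ζ ^ a) ^ t * (ζ ^ b) ^ t = 0 := by
  rw [← sum_zpow_pow_eq_zero hζ (e := ((a + b : ℕ) : ℤ)) fun h => ?_]
  · refine Finset.sum_congr rfl fun t _ => ?_
    rw [zpow_natCast, pow_add, mul_pow]
  · exact absurd (Nat.le_of_dvd h0 (Int.natCast_dvd_natCast.1 h)) (by omega)

end RootsOfUnity

/-! ### Vectors attaining the radius under all phases. -/

section Extremal

variable {ι : Type*} [Fintype ι]

theorem dotProduct_conjTranspose_mulVec (G : Matrix ι ι ℂ) (u v : ι → ℂ) :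
    star u ⬝ᵥ (Gᴴ *ᵥ v) = star (star v ⬝ᵥ (G *ᵥ u)) := by
  rw [← Matrix.star_dotProduct, Matrix.star_mulVec, Matrix.dotProduct_mulVec]

variable [DecidableEq ι]

open scoped ComplexOrder in
/-- A unit vector at which the quadratic form of a matrix of numerical radius at most one takes
the value one is an eigenvector of the Hermitian part. -/
theorem add_conjTranspose_mulVec_of_extremal {G : Matrix ι ι ℂ}
    (hG : ∀ v : ι → ℂ, star v ⬝ᵥ v = 1 → ‖star v ⬝ᵥ (G *ᵥ v)‖ ≤ 1) {u : ι → ℂ}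
    (hu : star u ⬝ᵥ u = 1) (h : (star u ⬝ᵥ (G *ᵥ u)).re = 1) :
    G *ᵥ u + Gᴴ *ᵥ u = (2 : ℂ) • u := by
  have hquad : ∀ v : ι → ℂ, star v ⬝ᵥ (((2 : ℂ) • (1 : Matrix ι ι ℂ) - (G + Gᴴ)) *ᵥ v) =
      ((2 * (∑ i, ‖v i‖ ^ 2) - 2 * (star v ⬝ᵥ (G *ᵥ v)).re : ℝ) : ℂ) := fun v => by
    rw [Matrix.sub_mulVec, Matrix.add_mulVec, dotProduct_sub, dotProduct_add,
      dotProduct_conjTranspose_mulVec, Matrix.smul_mulVec, Matrix.one_mulVec, dotProduct_smul,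
      dotProduct_star_self_eq_sum, RCLike.star_def, Complex.add_conj, smul_eq_mul]
    push_cast
    ring
  -- The form of this matrix vanishes at `u`; for a positive semidefinite matrix this puts `u` in
  -- the kernel.
  have hpsd : ((2 : ℂ) • (1 : Matrix ι ι ℂ) - (G + Gᴴ)).PosSemidef := by
    refine Matrix.PosSemidef.of_dotProduct_mulVec_nonneg ?_ fun v => ?_
    · ext i j
      simp only [Matrix.conjTranspose_apply, Matrix.sub_apply, Matrix.add_apply,
        Matrix.smul_apply, Matrix.one_apply, eq_comm (a := j), star_sub, star_add, star_star,
        add_comm]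
      split_ifs <;> simp
    · rw [hquad v, Complex.zero_le_real]
      have h1 := norm_quadForm_le_mul hG v
      have h2 := (Complex.abs_re_le_norm _).trans h1
      have h3 := le_abs_self (star v ⬝ᵥ (G *ᵥ v)).re
      linarith
  have h0 := (hpsd.dotProduct_mulVec_zero_iff u).1 (by
    rw [hquad u, h, sum_norm_sq_eq_one hu]; simp)
  rw [Matrix.sub_mulVec, Matrix.add_mulVec, Matrix.smul_mulVec, Matrix.one_mulVec,
    sub_eq_zero] at h0
  exact h0.symm

/-- The average over `t` of the phase combinations is `F i`, which attains the bound at `u`; hence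
each combination attains it, and `u` satisfies the extremal equation for every `t`. The bound `hM`
keeps both differences and sums of exponents nonzero modulo `M`, except in the trivial cases, so the
terms with `F j` and with its adjoint can be separated. -/
theorem mulVec_eq_zero_of_phases {F : ι → Matrix ι ι ℂ} {s : ι → ℕ} (hs : Function.Injective s)
    {i : ι} (hsi : s i = 0) {M : ℕ} (hM : ∀ j l, s j + s l < M) {ζ : ℂ}
    (hζ : IsPrimitiveRoot ζ M) (hζ1 : ‖ζ‖ = 1)
    (hF : ∀ t : ℕ, ∀ v : ι → ℂ, star v ⬝ᵥ v = 1 →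
      ‖star v ⬝ᵥ ((∑ j, (ζ ^ s j) ^ t • F j) *ᵥ v)‖ ≤ 1)
    {u : ι → ℂ} (hu : star u ⬝ᵥ u = 1) (h1 : ‖star u ⬝ᵥ (F i *ᵥ u)‖ = 1) :
    (∀ j, j ≠ i → F j *ᵥ u = 0 ∧ (F j)ᴴ *ᵥ u = 0) ∧
      star (star u ⬝ᵥ (F i *ᵥ u)) • (F i *ᵥ u) +
        (star u ⬝ᵥ (F i *ᵥ u)) • ((F i)ᴴ *ᵥ u) = (2 : ℂ) • u := by
  set γ := star u ⬝ᵥ (F i *ᵥ u) with hγ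
  have hM0 : 0 < M := lt_of_le_of_lt (Nat.zero_le _) (hM i i)
  have hMC : (M : ℂ) ≠ 0 := by exact_mod_cast hM0.ne'
  have hγγ : star γ * γ = 1 := by
    rw [RCLike.star_def, Complex.conj_mul', h1]; simp
  have hγ0 : γ ≠ 0 := fun h => by rw [h] at h1; simp at h1
  have hζn : ∀ j t, star ((ζ ^ s j) ^ t) * (ζ ^ s j) ^ t = 1 := fun j t => by
    rw [RCLike.star_def, Complex.conj_mul', norm_pow, norm_pow, hζ1]; simp
  have hs0 : ∀ j, j ≠ i → 0 < s j := fun j hj => by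
    rcases Nat.eq_zero_or_pos (s j) with h | h
    · exact absurd (hs (h.trans hsi.symm)) hj
    · exact h
  have hci : ∀ t, (ζ ^ s i) ^ t = 1 := fun t => by simp [hsi]
  have hsum : ∀ j, j ≠ i → ∑ t ∈ Finset.range M, (ζ ^ s j) ^ t = 0 := fun j hj => by
    have := sum_phase_mul_phase hζ (a := s j) (b := s i) (by have := hs0 j hj; omega) (hM j i)
    simpa only [hci, mul_one] using this
  have hsum_star : ∀ j, j ≠ i → ∑ t ∈ Finset.range M, star ((ζ ^ s j) ^ t) = 0 := fun j hj => by
    rw [← star_sum, hsum j hj, star_zero]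
  have horth : ∀ j l, ∑ t ∈ Finset.range M, star ((ζ ^ s j) ^ t) * (ζ ^ s l) ^ t =
      if l = j then (M : ℂ) else 0 := fun j l => by
    split_ifs with h
    · subst h
      simp only [hζn, Finset.sum_const, Finset.card_range, nsmul_eq_mul, mul_one]
    · exact sum_star_phase_mul_phase hζ hζ1 (by have := hM j j; omega) (by have := hM l l; omega)
        (fun h' => h (hs h'.symm))
  have hanti : ∀ j, j ≠ i → ∀ l, ∑ t ∈ Finset.range M, (ζ ^ s j) ^ t * (ζ ^ s l) ^ t = 0 :=
    fun j hj l => sum_phase_mul_phase hζ (by have := hs0 j hj; omega) (hM j l)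
  have hanti_star : ∀ j, j ≠ i → ∀ l,
      ∑ t ∈ Finset.range M, star ((ζ ^ s j) ^ t) * star ((ζ ^ s l) ^ t) = 0 := fun j hj l => by
    have := congrArg star (hanti j hj l)
    rw [star_sum, star_zero] at this
    rw [← this]
    exact Finset.sum_congr rfl fun t _ => by rw [star_mul']
  set G : ℕ → Matrix ι ι ℂ := fun t => ∑ j, (ζ ^ s j) ^ t • F j with hG
  have hGu : ∀ t, G t *ᵥ u = ∑ j, (ζ ^ s j) ^ t • (F j *ᵥ u) := fun t => by
    simp only [hG, Matrix.sum_mulVec, Matrix.smul_mulVec]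
  have hGHu : ∀ t, (G t)ᴴ *ᵥ u = ∑ j, star ((ζ ^ s j) ^ t) • ((F j)ᴴ *ᵥ u) := fun t => by
    simp only [hG, Matrix.conjTranspose_sum, Matrix.conjTranspose_smul, Matrix.sum_mulVec,
      Matrix.smul_mulVec]
  -- every phase combination attains the bound at `u`
  have hle : ∀ t, (star γ * (star u ⬝ᵥ (G t *ᵥ u))).re ≤ 1 := fun t => by
    refine (Complex.re_le_norm _).trans ?_
    rw [norm_mul, norm_star, h1, one_mul]
    exact hF t u hu
  have havg : ∑ t ∈ Finset.range M, (star γ * (star u ⬝ᵥ (G t *ᵥ u))).re =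
      ∑ t ∈ Finset.range M, (1 : ℝ) := by
    rw [← Complex.re_sum, ← Finset.mul_sum, ← dotProduct_sum]
    have : ∑ t ∈ Finset.range M, G t *ᵥ u = (M : ℂ) • (F i *ᵥ u) := by
      simp only [hGu]
      rw [Finset.sum_comm]
      simp only [← Finset.sum_smul]
      rw [Finset.sum_eq_single i (fun j _ hj => by rw [hsum j hj, zero_smul]) (by simp)]
      simp [hci]
    rw [this, dotProduct_smul, ← hγ, smul_eq_mul, mul_left_comm, hγγ]
    simp
  have heq : ∀ t ∈ Finset.range M, (star γ * (star u ⬝ᵥ (G t *ᵥ u))).re = 1 :=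
    (Finset.sum_eq_sum_iff_of_le fun t _ => hle t).1 havg
  have hext : ∀ t ∈ Finset.range M,
      star γ • (G t *ᵥ u) + γ • ((G t)ᴴ *ᵥ u) = (2 : ℂ) • u := fun t ht => by
    have := add_conjTranspose_mulVec_of_extremal (G := star γ • G t) (fun v hv => by
      rw [Matrix.smul_mulVec, dotProduct_smul, smul_eq_mul, norm_mul, norm_star, h1, one_mul]
      exact hF t v hv) hu (by
      rw [Matrix.smul_mulVec, dotProduct_smul, smul_eq_mul]
      exact heq t ht)
    simpa only [Matrix.conjTranspose_smul, star_star, Matrix.smul_mulVec] using this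
  -- Sum of the extremal equations with weights `c t`. Below, `c` is the conjugate character of `j`,
  -- isolating `F j *ᵥ u`; then the character itself, isolating the adjoint term; then the constant
  -- 1, isolating `i`.
  have hfourier : ∀ c : ℕ → ℂ,
      star γ • (∑ j, (∑ t ∈ Finset.range M, c t * (ζ ^ s j) ^ t) • (F j *ᵥ u)) +
      γ • (∑ j, (∑ t ∈ Finset.range M, c t * star ((ζ ^ s j) ^ t)) • ((F j)ᴴ *ᵥ u)) =
      (∑ t ∈ Finset.range M, c t) • (2 : ℂ) • u := fun c => by
    have e : ∑ t ∈ Finset.range M, c t • (2 : ℂ) • u = ∑ t ∈ Finset.range M,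
        c t • (star γ • (G t *ᵥ u) + γ • ((G t)ᴴ *ᵥ u)) :=
      Finset.sum_congr rfl fun t ht => by rw [hext t ht]
    rw [Finset.sum_smul, e]
    simp only [smul_add, Finset.sum_add_distrib, hGu, hGHu, Finset.sum_smul, Finset.smul_sum]
    rw [Finset.sum_comm (s := Finset.range M), Finset.sum_comm (s := Finset.range M)]
    simp only [smul_smul]
    congr 1 <;> refine Finset.sum_congr rfl fun j _ => Finset.sum_congr rfl fun t _ => ?_ <;>
      congr 1 <;> ring
  refine ⟨fun j hj => ⟨?_, ?_⟩, ?_⟩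
  · have := hfourier fun t => star ((ζ ^ s j) ^ t)
    simp only [horth, hanti_star j hj, hsum_star j hj, zero_smul, Finset.sum_const_zero,
      smul_zero, add_zero, ite_smul, Finset.sum_ite_eq', Finset.mem_univ, if_true] at this
    simpa [hγ0, hMC] using this
  · have := hfourier fun t => (ζ ^ s j) ^ t
    simp only [hanti j hj, hsum j hj, zero_smul, Finset.sum_const_zero, smul_zero, zero_add] at this
    have horth' : ∀ l, ∑ t ∈ Finset.range M, (ζ ^ s j) ^ t * star ((ζ ^ s l) ^ t) =
        if l = j then (M : ℂ) else 0 := fun l => by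
      rw [← Finset.sum_congr rfl fun t _ => mul_comm _ _, horth l j]
      simp only [eq_comm]
    simp only [horth', ite_smul, zero_smul, Finset.sum_ite_eq', Finset.mem_univ, if_true] at this
    simpa [hγ0, hMC] using this
  · have h2 := hfourier fun _ => 1
    simp only [one_mul] at h2
    rw [Finset.sum_eq_single i (fun j _ hj => by rw [hsum j hj, zero_smul]) (by simp),
      Finset.sum_eq_single i (fun j _ hj => by rw [hsum_star j hj, zero_smul]) (by simp)] at h2
    simp only [hci, star_one, Finset.sum_const, Finset.card_range, nsmul_eq_mul, mul_one] at h2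
    rw [smul_comm _ (M : ℂ), smul_comm γ (M : ℂ), ← smul_add] at h2
    exact smul_right_injective _ hMC h2

end Extremal

/-! ### Action on diagonal matrices. -/

section ProductBases

theorem conjTranspose_mul_self_of_mem_unitaryGroup {ι : Type*} [Fintype ι] [DecidableEq ι]
    {U : Matrix ι ι ℂ} (hU : U ∈ Matrix.unitaryGroup ι ℂ) : Uᴴ * U = 1 := by
  simpa [Matrix.star_eq_conjTranspose] using Matrix.mem_unitaryGroup_iff'.1 hU

theorem self_mul_conjTranspose_of_mem_unitaryGroup {ι : Type*} [Fintype ι] [DecidableEq ι]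
    {U : Matrix ι ι ℂ} (hU : U ∈ Matrix.unitaryGroup ι ℂ) : U * Uᴴ = 1 := by
  simpa [Matrix.star_eq_conjTranspose] using Matrix.mem_unitaryGroup_iff.1 hU

theorem diagonal_eq_sum_smul_single {ι : Type*} [Fintype ι] [DecidableEq ι] (d : ι → ℂ) :
    Matrix.diagonal d = ∑ i, d i • Matrix.single i i (1 : ℂ) := by
  rw [← Matrix.sum_single_eq_diagonal]
  simp [Matrix.smul_single]

variable {m : ℕ} {n : Fin m → ℕ}

/-- The hypothesis that `φ` preserves the numerical radius of all tensor products. -/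
def PreservesRadius
    (φ : Matrix (MultiIndex n) (MultiIndex n) ℂ →ₗ[ℂ] Matrix (MultiIndex n) (MultiIndex n) ℂ) :
    Prop :=
  ∀ A : ∀ k : Fin m, Matrix (Fin (n k)) (Fin (n k)) ℂ,
    numericalRadius (φ (tensorMatrix A)) = numericalRadius (tensorMatrix A)

/-- Conjugation by a matrix as a linear map. -/
def conjLinear {ι : Type*} [Fintype ι] (U : Matrix ι ι ℂ) : Matrix ι ι ℂ →ₗ[ℂ] Matrix ι ι ℂ where
  toFun X := U * X * Uᴴ
  map_add' X Y := by rw [Matrix.mul_add, Matrix.add_mul]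
  map_smul' c X := by simp

theorem conjLinear_apply {ι : Type*} [Fintype ι] (U X : Matrix ι ι ℂ) :
    conjLinear U X = U * X * Uᴴ := rfl

variable
  {φ : Matrix (MultiIndex n) (MultiIndex n) ℂ →ₗ[ℂ] Matrix (MultiIndex n) (MultiIndex n) ℂ}

theorem PreservesRadius.comp_conj (hφ : PreservesRadius φ)
    {V : ∀ k, Matrix (Fin (n k)) (Fin (n k)) ℂ}
    (hV : ∀ k, V k ∈ Matrix.unitaryGroup (Fin (n k)) ℂ) :
    PreservesRadius (φ ∘ₗ conjLinear (tensorMatrix V)) := fun A => by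
  rw [LinearMap.comp_apply, conjLinear_apply, tensorMatrix_conj, hφ, ← tensorMatrix_conj,
    numericalRadius_conj (tensorMatrix_mem_unitaryGroup hV)]

theorem PreservesRadius.conj_comp (hφ : PreservesRadius φ)
    {U : Matrix (MultiIndex n) (MultiIndex n) ℂ} (hU : U ∈ Matrix.unitaryGroup (MultiIndex n) ℂ) :
    PreservesRadius (conjLinear U ∘ₗ φ) := fun A => by
  rw [LinearMap.comp_apply, conjLinear_apply, numericalRadius_conj hU, hφ]

theorem PreservesRadius.norm_quadForm_diagonal_le [Nonempty (MultiIndex n)]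
    (hφ : PreservesRadius φ) {d : ∀ k, Fin (n k) → ℂ} (hd : ∀ k a, ‖d k a‖ = 1)
    {v : MultiIndex n → ℂ} (hv : star v ⬝ᵥ v = 1) :
    ‖star v ⬝ᵥ (φ (Matrix.diagonal fun i => ∏ k, d k (i k)) *ᵥ v)‖ ≤ 1 := by
  refine (norm_quadForm_le_numericalRadius _ hv).trans ?_
  rw [← tensorMatrix_diagonal, hφ]
  refine numericalRadius_le fun u hu => norm_quadForm_le (fun i => le_of_eq ?_) hu
  rw [sum_norm_tensorMatrix_row, sum_norm_tensorMatrix_col, Finset.prod_eq_one,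
    Finset.prod_eq_one]
  · norm_num
  · intro k _
    rw [Fintype.sum_eq_single (i k) fun b hb => by simp [hb], Matrix.diagonal_apply_eq, hd]
  · intro k _
    rw [Fintype.sum_eq_single (i k) fun b hb => by simp [Ne.symm hb], Matrix.diagonal_apply_eq, hd]

theorem PreservesRadius.one_le_numericalRadius_single
    (hφ : PreservesRadius φ) (i : MultiIndex n) :
    1 ≤ numericalRadius (φ (Matrix.single i i 1)) := by
  rw [← tensorMatrix_single, hφ, tensorMatrix_single]
  refine le_trans (le_of_eq ?_)
    (norm_quadForm_le_numericalRadius _ (star_single_dotProduct_single i))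
  simp

/-- The phases used must be products of phases in the separate coordinates. Mixed-radix numbering of
the multi-indices provides exponents that are both injective and additive over coordinates. -/
theorem PreservesRadius.exists_unit_vector (hφ : PreservesRadius φ) (i : MultiIndex n) :
    ∃ u : MultiIndex n → ℂ, star u ⬝ᵥ u = 1 ∧
      ‖star u ⬝ᵥ (φ (Matrix.single i i 1) *ᵥ u)‖ = 1 ∧
      (∀ j, j ≠ i → φ (Matrix.single j j 1) *ᵥ u = 0 ∧ (φ (Matrix.single j j 1))ᴴ *ᵥ u = 0) ∧
      star (star u ⬝ᵥ (φ (Matrix.single i i 1) *ᵥ u)) • (φ (Matrix.single i i 1) *ᵥ u) +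
        (star u ⬝ᵥ (φ (Matrix.single i i 1) *ᵥ u)) • ((φ (Matrix.single i i 1))ᴴ *ᵥ u) =
          (2 : ℂ) • u := by
  have : Nonempty (MultiIndex n) := ⟨i⟩
  have : ∀ k, NeZero (n k) := fun k => ⟨fun h => (h ▸ i k).elim0⟩
  -- Relabelling each coordinate so that `i` gets exponent 0.
  let e : MultiIndex n → MultiIndex n := fun j k => Equiv.swap (i k) 0 (j k)
  have he : Function.Injective e := fun j l h => funext fun k =>
    (Equiv.swap (i k) 0).injective (congrFun h k)
  let s : MultiIndex n → ℕ := fun j => finPiFinEquiv (e j)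
  have hs : Function.Injective s := fun j l h =>
    he (finPiFinEquiv.injective (Fin.ext h))
  have hsum : ∀ j, s j = ∑ k, (e j k : ℕ) * ∏ l : Fin k, n (Fin.castLE k.is_lt.le l) :=
    fun j => finPiFinEquiv_apply _
  have hsi : s i = 0 := by
    rw [hsum]
    exact Finset.sum_eq_zero fun k _ => by simp [e]
  have hlt : ∀ j, s j < ∏ k, n k := fun j => (finPiFinEquiv (e j)).is_lt
  -- The factor 2 keeps the sum of two exponents below `M`.
  set M : ℕ := 2 * ∏ k, n k with hM
  have hM0 : M ≠ 0 := by have := hlt i; omega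
  have hζ := Complex.isPrimitiveRoot_exp M hM0
  have hζ1 := hζ.norm'_eq_one hM0
  have hF : ∀ t : ℕ, ∀ v : MultiIndex n → ℂ, star v ⬝ᵥ v = 1 →
      ‖star v ⬝ᵥ ((∑ j, (Complex.exp (2 * Real.pi * Complex.I / M) ^ s j) ^ t •
        φ (Matrix.single j j 1)) *ᵥ v)‖ ≤ 1 := fun t v hv => by
    have := hφ.norm_quadForm_diagonal_le (d := fun k a =>
      (Complex.exp (2 * Real.pi * Complex.I / M) ^
        ((Equiv.swap (i k) 0 a : ℕ) * ∏ l : Fin k, n (Fin.castLE k.is_lt.le l))) ^ t)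
      (fun k a => by rw [norm_pow, norm_pow, hζ1, one_pow, one_pow]) hv
    rw [diagonal_eq_sum_smul_single, map_sum] at this
    simp only [map_smul, Finset.prod_pow, Finset.prod_pow_eq_pow_sum] at this
    simpa only [hsum, e] using this
  have hu : ∃ u : MultiIndex n → ℂ, star u ⬝ᵥ u = 1 ∧
      ‖star u ⬝ᵥ (φ (Matrix.single i i 1) *ᵥ u)‖ =
        numericalRadius (φ (Matrix.single i i 1)) :=
    exists_norm_quadForm_eq_numericalRadius _
  obtain ⟨u, hu, hu1⟩ := hu
  have hle : ‖star u ⬝ᵥ (φ (Matrix.single i i 1) *ᵥ u)‖ ≤ 1 := by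
    refine (norm_quadForm_le_numericalRadius _ hu).trans ?_
    rw [← tensorMatrix_single, hφ, tensorMatrix_single]
    refine numericalRadius_le fun u hu => norm_quadForm_le (fun p => ?_) hu
    simp only [Matrix.single_apply]
    by_cases hp : i = p <;> simp [hp, apply_ite norm]
    norm_num
  have h1 : ‖star u ⬝ᵥ (φ (Matrix.single i i 1) *ᵥ u)‖ = 1 :=
    le_antisymm hle (hu1 ▸ hφ.one_le_numericalRadius_single i)
  have := mulVec_eq_zero_of_phases hs hsi (M := M)
    (fun j l => by have := hlt j; have := hlt l; omega) hζ hζ1 hF hu h1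
  exact ⟨u, hu, h1, this.1, this.2⟩

/-- A map preserving the numerical radius of tensor products is, on diagonal matrices, a unitary
conjugation up to unimodular factors. -/
theorem PreservesRadius.exists_unitary_diagonal (hφ : PreservesRadius φ) :
    ∃ U ∈ Matrix.unitaryGroup (MultiIndex n) ℂ, ∃ ξ : MultiIndex n → ℂ, (∀ i, ‖ξ i‖ = 1) ∧
      ∀ d, φ (Matrix.diagonal d) = U * Matrix.diagonal (fun i => d i * ξ i) * Uᴴ := by
  choose u hu h1 h0 h2 using hφ.exists_unit_vector
  -- Pair the extremal equation for `u j` with `u i`: both terms on the left vanish because the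
  -- image of the unit at `j` and its adjoint kill `u i`.
  have horth : ∀ i j, i ≠ j → star (u i) ⬝ᵥ u j = 0 := fun i j hij => by
    have e := congrArg (fun v => star (u i) ⬝ᵥ v) (h2 j)
    simp only [dotProduct_add, dotProduct_smul] at e
    rw [Matrix.dotProduct_mulVec (star (u i)) ((φ _)ᴴ), ← Matrix.star_mulVec, (h0 i j hij.symm).1,
      Matrix.dotProduct_mulVec (star (u i)) (φ _), ← Matrix.conjTranspose_conjTranspose (φ _),
      ← Matrix.star_mulVec, Matrix.conjTranspose_conjTranspose, (h0 i j hij.symm).2] at e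
    simpa using e.symm
  let U : Matrix (MultiIndex n) (MultiIndex n) ℂ := Matrix.of fun p i => u i p
  have hUe : ∀ (X : Matrix (MultiIndex n) (MultiIndex n) ℂ) p q,
      (Uᴴ * X * U) p q = star (u p) ⬝ᵥ (X *ᵥ u q) := fun X p q => by
    rw [Matrix.mul_assoc]
    simp [Matrix.mul_apply, dotProduct, Matrix.mulVec, U, Matrix.conjTranspose_apply]
  have hUU : Uᴴ * U = 1 := by
    ext p q
    have := hUe 1 p q
    rw [Matrix.mul_one, Matrix.one_mulVec] at this
    rw [this]
    by_cases hpq : p = q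
    · subst hpq; rw [hu, Matrix.one_apply_eq]
    · rw [horth p q hpq, Matrix.one_apply_ne hpq]
  have hU : U ∈ Matrix.unitaryGroup (MultiIndex n) ℂ := by
    rw [Matrix.mem_unitaryGroup_iff', Matrix.star_eq_conjTranspose, hUU]
  have hUU' := self_mul_conjTranspose_of_mem_unitaryGroup hU
  refine ⟨U, hU, fun i => star (u i) ⬝ᵥ (φ (Matrix.single i i 1) *ᵥ u i), h1, fun d => ?_⟩
  have key : Uᴴ * φ (Matrix.diagonal d) * U =
      Matrix.diagonal fun i => d i * (star (u i) ⬝ᵥ (φ (Matrix.single i i 1) *ᵥ u i)) := by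
    rw [diagonal_eq_sum_smul_single, map_sum]
    ext p q
    rw [hUe, Matrix.sum_mulVec, dotProduct_sum]
    simp only [map_smul, Matrix.smul_mulVec, dotProduct_smul, smul_eq_mul]
    rw [Fintype.sum_eq_single q fun j hj => by rw [(h0 q j hj).1, dotProduct_zero, mul_zero]]
    by_cases hpq : p = q
    · subst hpq; rw [Matrix.diagonal_apply_eq]
    · rw [Matrix.diagonal_apply_ne _ hpq, Matrix.dotProduct_mulVec,
        ← Matrix.conjTranspose_conjTranspose (φ _), ← Matrix.star_mulVec,
        (h0 p q (Ne.symm hpq)).2, star_zero, zero_dotProduct,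
        mul_zero]
  rw [← key]
  simp only [← Matrix.mul_assoc, hUU', Matrix.one_mul]
  rw [Matrix.mul_assoc, hUU', Matrix.mul_one]

end ProductBases

/-! ### The phases reduce to one scalar. -/

section Scalar

theorem matrix_induction_hermitian {ι : Type*} [Fintype ι] {P : Matrix ι ι ℂ → Prop}
    (hherm : ∀ X : Matrix ι ι ℂ, X.IsHermitian → P X)
    (hlin : ∀ (c : ℂ) (X Y : Matrix ι ι ℂ), P X → P Y → P (X + c • Y)) (X : Matrix ι ι ℂ) : P X := by
  have h := realPart_add_I_smul_imaginaryPart X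
  rw [← h]
  exact hlin _ _ _ (hherm _ (realPart X).2) (hherm _ (imaginaryPart X).2)

theorem exists_unitary_conj_diagonal {ι : Type*} [Fintype ι] [DecidableEq ι] {X : Matrix ι ι ℂ}
    (hX : X.IsHermitian) : ∃ V ∈ Matrix.unitaryGroup ι ℂ, ∃ d : ι → ℝ,
      X = V * Matrix.diagonal (fun i => (d i : ℂ)) * Vᴴ :=
  ⟨hX.eigenvectorUnitary, hX.eigenvectorUnitary.2, hX.eigenvalues, hX.spectral_theorem⟩

variable {m : ℕ} {n : Fin m → ℕ}

theorem tensorSlot_single_diagonal (i : MultiIndex n) (k : Fin m) (d : Fin (n k) → ℂ) :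
    tensorSlot (fun l => Matrix.single (i l) (i l) (1 : ℂ)) k (Matrix.diagonal d) =
      Matrix.diagonal fun p => d (p k) * if ∀ l, l ≠ k → p l = i l then 1 else 0 := by
  have h : (Function.update (fun l => Matrix.single (i l) (i l) (1 : ℂ)) k (Matrix.diagonal d)) =
      fun l => Matrix.diagonal (Function.update (fun l => Pi.single (i l) (1 : ℂ)) k d l) := by
    funext l
    by_cases hl : l = k
    · subst hl; simp
    · simp [hl, Matrix.diagonal_single]
  rw [tensorSlot_apply, h, tensorMatrix_diagonal]
  congr 1
  funext p
  rw [← Finset.mul_prod_erase _ _ (Finset.mem_univ k), Function.update_self]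
  congr 1
  rw [Finset.prod_congr rfl fun l hl => by
    rw [Function.update_of_ne (Finset.ne_of_mem_erase hl), Pi.single_apply],
    Finset.prod_ite_zero]
  simp

theorem tensorSlot_conj (A : ∀ k, Matrix (Fin (n k)) (Fin (n k)) ℂ) (k : Fin m)
    (V X : Matrix (Fin (n k)) (Fin (n k)) ℂ) :
    tensorSlot A k (V * X * Vᴴ) = tensorMatrix (Function.update (fun _ => 1) k V) *
      tensorSlot A k X * (tensorMatrix (Function.update (fun _ => 1) k V))ᴴ := by
  rw [tensorSlot_apply, tensorSlot_apply, tensorMatrix_conj]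
  congr 1
  funext l
  by_cases hl : l = k
  · subst hl; simp
  · simp [hl]

theorem update_one_mem_unitaryGroup {k : Fin m} {V : Matrix (Fin (n k)) (Fin (n k)) ℂ}
    (hV : V ∈ Matrix.unitaryGroup (Fin (n k)) ℂ) (l : Fin m) :
    Function.update (fun l => (1 : Matrix (Fin (n l)) (Fin (n l)) ℂ)) k V l ∈
      Matrix.unitaryGroup (Fin (n l)) ℂ := by
  by_cases hl : l = k
  · subst hl; simpa using hV
  · simp [hl, one_mem]

variable
  {φ : Matrix (MultiIndex n) (MultiIndex n) ℂ →ₗ[ℂ] Matrix (MultiIndex n) (MultiIndex n) ℂ}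

/-- For Hermitian `X`, `T X` and `T 1` are diagonal in a common product basis, so their images are
diagonal in a common orthonormal basis with the same phases. The resulting identities no longer
mention the basis and are linear in `X`, hence hold for all `X`. -/
theorem PreservesRadius.commute_slot (hφ : PreservesRadius φ) (i : MultiIndex n) (k : Fin m)
    (X : Matrix (Fin (n k)) (Fin (n k)) ℂ) :
    let T := tensorSlot (fun l => Matrix.single (i l) (i l) (1 : ℂ)) k
    φ (T X) * φ (T 1) = φ (T 1) * φ (T X) ∧ φ (T X) * ((φ (T 1))ᴴ * φ (T 1)) = φ (T X) := by
  intro T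
  induction X using matrix_induction_hermitian with
  | hlin c X Y hX hY =>
    simp only [map_add, map_smul, Matrix.add_mul, Matrix.mul_add, Matrix.smul_mul,
      Matrix.mul_smul, hX.1, hX.2, hY.1, hY.2, and_self]
  | hherm X hX =>
    obtain ⟨V, hV, d, rfl⟩ := exists_unitary_conj_diagonal hX
    obtain ⟨U, hU, ξ, hξ, h⟩ :=
      (hφ.comp_conj (update_one_mem_unitaryGroup hV)).exists_unitary_diagonal
    have hUU := conjTranspose_mul_self_of_mem_unitaryGroup hU
    have hT : ∀ d, φ (T (V * Matrix.diagonal d * Vᴴ)) =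
        U * Matrix.diagonal (fun p => d (p k) *
          (if ∀ l, l ≠ k → p l = i l then 1 else 0) * ξ p) * Uᴴ := fun d => by
      rw [tensorSlot_conj, tensorSlot_single_diagonal, ← h]
      rfl
    have hT1 : φ (T 1) = U * Matrix.diagonal (fun p =>
        (if ∀ l, l ≠ k → p l = i l then 1 else 0) * ξ p) * Uᴴ := by
      have := hT 1
      rw [Matrix.diagonal_one', Matrix.mul_one, self_mul_conjTranspose_of_mem_unitaryGroup hV]
        at this
      simpa using this
    have hmul : ∀ a b : MultiIndex n → ℂ,
        U * Matrix.diagonal a * Uᴴ * (U * Matrix.diagonal b * Uᴴ) =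
          U * Matrix.diagonal (fun p => a p * b p) * Uᴴ := fun a b => by
      rw [← Matrix.diagonal_mul_diagonal]
      calc _ = U * Matrix.diagonal a * (Uᴴ * U) * Matrix.diagonal b * Uᴴ := by
            simp only [Matrix.mul_assoc]
        _ = _ := by rw [hUU, Matrix.mul_one]; simp only [Matrix.mul_assoc]
    have hstar : ∀ a : MultiIndex n → ℂ,
        (U * Matrix.diagonal a * Uᴴ)ᴴ = U * Matrix.diagonal (star a) * Uᴴ := fun a => by
      simp [Matrix.conjTranspose_mul, Matrix.mul_assoc, Matrix.diagonal_conjTranspose]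
    rw [hT, hT1, hstar, hmul, hmul, hmul, hmul]
    refine ⟨by simp only [mul_comm], ?_⟩
    congr 3
    funext p
    have hp : star (ξ p) * ξ p = 1 := by
      rw [RCLike.star_def, Complex.conj_mul', hξ]; simp
    simp only [Pi.star_apply, star_mul']
    split_ifs
    · simp only [star_one, one_mul, mul_one, hp]
    · simp

theorem tensorSlot_single_apply_update (i : MultiIndex n) (k : Fin m)
    (X : Matrix (Fin (n k)) (Fin (n k)) ℂ) (a b : Fin (n k)) :
    tensorSlot (fun l => Matrix.single (i l) (i l) (1 : ℂ)) k X
      (Function.update i k a) (Function.update i k b) = X a b := by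
  rw [tensorSlot_apply, tensorMatrix_update_apply, Finset.prod_eq_one, Function.update_self,
    Function.update_self, mul_one]
  intro l hl
  rw [Function.update_of_ne (Finset.ne_of_mem_erase hl),
    Function.update_of_ne (Finset.ne_of_mem_erase hl), Matrix.single_apply_same]

/-- Each `φ (T X)` lives on the block of indices agreeing with `i` off `k`, and its entry at `(p,
q)` vanishes if `ξ p ≠ ξ q`. But `X ↦ φ (T X)` is injective into a block of the same dimension, so
it is onto and some entry rules out distinct phases. -/
theorem PreservesRadius.phase_update (hφ : PreservesRadius φ) {ξ : MultiIndex n → ℂ}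
    (hξ : ∀ i, ‖ξ i‖ = 1) (h : ∀ d, φ (Matrix.diagonal d) = Matrix.diagonal fun i => d i * ξ i)
    (i : MultiIndex n) (k : Fin m) (b : Fin (n k)) : ξ (Function.update i k b) = ξ i := by
  set T := tensorSlot (fun l => Matrix.single (i l) (i l) (1 : ℂ)) k with hT
  have hcomm := hφ.commute_slot i k
  rw [← hT] at hcomm
  have hD : φ (T 1) = Matrix.diagonal fun p =>
      (if ∀ l, l ≠ k → p l = i l then 1 else 0) * ξ p := by
    rw [← Matrix.diagonal_one, tensorSlot_single_diagonal, h]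
    simp
  have hξ0 : ∀ p, ξ p ≠ 0 := fun p hp => by have := hξ p; rw [hp] at this; simp at this
  have hmul : ∀ X p q, φ (T X) p q * ((if ∀ l, l ≠ k → q l = i l then 1 else 0) * ξ q) =
      ((if ∀ l, l ≠ k → p l = i l then 1 else 0) * ξ p) * φ (T X) p q := fun X p q => by
    have := congrFun (congrFun (hcomm X).1 p) q
    rwa [hD, Matrix.mul_diagonal, Matrix.diagonal_mul] at this
  have hright : ∀ X p q, ¬ (∀ l, l ≠ k → q l = i l) → φ (T X) p q = 0 := fun X p q hq => by
    have := congrFun (congrFun (hcomm X).2 p) q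
    rw [hD, ← Matrix.mul_assoc, Matrix.mul_diagonal, if_neg hq] at this
    rw [← this]; simp
  have hleft : ∀ X p q, ¬ (∀ l, l ≠ k → p l = i l) → φ (T X) p q = 0 := fun X p q hp => by
    by_cases hq : ∀ l, l ≠ k → q l = i l
    · have := hmul X p q
      rw [if_pos hq, if_neg hp] at this
      simpa [hξ0] using this
    · exact hright X p q hq
  let j : Matrix (Fin (n k)) (Fin (n k)) ℂ →ₗ[ℂ] Matrix (Fin (n k)) (Fin (n k)) ℂ :=
    { toFun := fun X => Matrix.of fun a b =>
        φ (T X) (Function.update i k a) (Function.update i k b)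
      map_add' := fun X Y => by ext; simp
      map_smul' := fun c X => by ext; simp }
  have hblock : ∀ p : MultiIndex n, (∀ l, l ≠ k → p l = i l) → Function.update i k (p k) = p :=
    fun p hp => by
      funext l
      by_cases hl : l = k
      · subst hl; simp
      · simp [hl, hp l hl]
  have hinj : Function.Injective j := by
    rw [injective_iff_map_eq_zero]
    intro X hX
    have hS : φ (T X) = 0 := by
      ext p q
      by_cases hp : ∀ l, l ≠ k → p l = i l
      · by_cases hq : ∀ l, l ≠ k → q l = i l
        · have := congrFun (congrFun hX (p k)) (q k)
          simpa [j, hblock p hp, hblock q hq] using this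
        · exact hright X p q hq
      · exact hleft X p q hp
    have hTX : T X = 0 := by
      refine eq_zero_of_numericalRadius_eq_zero ?_
      rw [hT, tensorSlot_apply, ← hφ, ← tensorSlot_apply, ← hT, hS]
      have : Nonempty (MultiIndex n) := ⟨i⟩
      obtain ⟨u, -, hu⟩ := exists_norm_quadForm_eq_numericalRadius
        (0 : Matrix (MultiIndex n) (MultiIndex n) ℂ)
      rw [← hu]; simp
    ext a c
    rw [← tensorSlot_single_apply_update i k X a c, ← hT, hTX]
    rfl
  obtain ⟨X, hX⟩ := (LinearMap.injective_iff_surjective.1 hinj) (Matrix.single (i k) b 1)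
  have h1 : φ (T X) i (Function.update i k b) = 1 := by
    have := congrFun (congrFun hX (i k)) b
    simpa [j] using this
  have h2 := hmul X i (Function.update i k b)
  rw [h1, if_pos (fun l hl => Function.update_of_ne hl _ _), if_pos fun _ _ => rfl] at h2
  simpa using h2

theorem PreservesRadius.phase_const (hφ : PreservesRadius φ) {ξ : MultiIndex n → ℂ}
    (hξ : ∀ i, ‖ξ i‖ = 1) (h : ∀ d, φ (Matrix.diagonal d) = Matrix.diagonal fun i => d i * ξ i)
    (i j : MultiIndex n) : ξ j = ξ i := by
  have key : ∀ s : Finset (Fin m), ξ (s.piecewise j i) = ξ i := fun s => by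
    induction s using Finset.induction_on with
    | empty => simp
    | insert k s _ ih => rw [Finset.piecewise_insert, hφ.phase_update hξ h, ih]
  simpa using key Finset.univ

/-- `φ` maps the diagonal algebra of a product basis onto that of an orthonormal basis, up to a
global phase. -/
def MapsProductBases
    (φ : Matrix (MultiIndex n) (MultiIndex n) ℂ →ₗ[ℂ] Matrix (MultiIndex n) (MultiIndex n) ℂ)
    (ξ : ℂ) : Prop :=
  ∀ V : ∀ k, Matrix (Fin (n k)) (Fin (n k)) ℂ, (∀ k, V k ∈ Matrix.unitaryGroup (Fin (n k)) ℂ) →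
    ∃ U ∈ Matrix.unitaryGroup (MultiIndex n) ℂ, ∀ d,
      φ (tensorMatrix V * Matrix.diagonal d * (tensorMatrix V)ᴴ) =
        ξ • (U * Matrix.diagonal d * Uᴴ)

theorem PreservesRadius.exists_unitary_diagonal_const (hφ : PreservesRadius φ) :
    ∃ U ∈ Matrix.unitaryGroup (MultiIndex n) ℂ, ∃ ξ : ℂ, ‖ξ‖ = 1 ∧
      ∀ d, φ (Matrix.diagonal d) = ξ • (U * Matrix.diagonal d * Uᴴ) := by
  obtain ⟨U, hU, ξ, hξ, h⟩ := hφ.exists_unitary_diagonal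
  rcases isEmpty_or_nonempty (MultiIndex n) with he | ⟨⟨i⟩⟩
  · exact ⟨1, one_mem _, 1, by simp, fun d => by ext p; exact he.elim p⟩
  have hUU := conjTranspose_mul_self_of_mem_unitaryGroup hU
  have hconst := (hφ.conj_comp (Unitary.star_mem hU)).phase_const hξ (fun d => by
    rw [LinearMap.comp_apply, conjLinear_apply, h, Matrix.star_eq_conjTranspose,
      Matrix.conjTranspose_conjTranspose]
    simp only [← Matrix.mul_assoc, hUU, Matrix.one_mul]
    rw [Matrix.mul_assoc, hUU, Matrix.mul_one]) i
  refine ⟨U, hU, ξ i, hξ i, fun d => ?_⟩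
  rw [h, ← Matrix.smul_mul, ← Matrix.mul_smul, ← Matrix.diagonal_smul]
  congr 3
  funext p
  rw [hconst p, Pi.smul_apply, smul_eq_mul, mul_comm]

theorem PreservesRadius.mapsProductBases (hφ : PreservesRadius φ) :
    ∃ ξ : ℂ, ‖ξ‖ = 1 ∧ MapsProductBases φ ξ := by
  obtain ⟨U₀, hU₀, ξ, hξ, h₀⟩ := hφ.exists_unitary_diagonal_const
  refine ⟨ξ, hξ, fun V hV => ?_⟩
  obtain ⟨U, hU, η, hη, h⟩ := (hφ.comp_conj hV).exists_unitary_diagonal_const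
  refine ⟨U, hU, fun d => ?_⟩
  -- In both bases the identity goes to a scalar matrix, so the scalar for `V` is the one for the
  -- standard basis.
  have h1 := h₀ 1
  have h2 := h 1
  rw [LinearMap.comp_apply, conjLinear_apply, Matrix.diagonal_one', Matrix.mul_one,
    self_mul_conjTranspose_of_mem_unitaryGroup (tensorMatrix_mem_unitaryGroup hV),
    ← Matrix.diagonal_one', h1, Matrix.diagonal_one', Matrix.mul_one, Matrix.mul_one,
    self_mul_conjTranspose_of_mem_unitaryGroup hU,
    self_mul_conjTranspose_of_mem_unitaryGroup hU₀] at h2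
  rcases isEmpty_or_nonempty (MultiIndex n) with he | ⟨⟨i⟩⟩
  · ext p; exact he.elim p
  have h3 : ξ = η := by simpa using congrFun (congrFun h2 i) i
  rw [h3, ← h d]
  rfl

end Scalar

/-! ### Adjoints, factor maps and Jordan products. -/

section JordanStructure

variable {m : ℕ} {n : Fin m → ℕ}

/-- Used to check multilinear identities on Hermitian tuples only, which are diagonal in a product
basis. -/
theorem tuple_induction_hermitian {P : (∀ k, Matrix (Fin (n k)) (Fin (n k)) ℂ) → Prop}
    (hherm : ∀ A, (∀ k, (A k).IsHermitian) → P A)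
    (hlin : ∀ A k (c : ℂ) X Y, P (Function.update A k X) → P (Function.update A k Y) →
      P (Function.update A k (X + c • Y))) (A : ∀ k, Matrix (Fin (n k)) (Fin (n k)) ℂ) : P A := by
  have key : ∀ s : Finset (Fin m), ∀ A : ∀ k, Matrix (Fin (n k)) (Fin (n k)) ℂ,
      (∀ k, k ∉ s → (A k).IsHermitian) → P A := fun s => by
    induction s using Finset.induction_on with
    | empty => exact fun A hA => hherm A fun k => hA k (by simp)
    | insert k s _ ih =>
      intro A hA
      rw [← Function.update_eq_self k A]
      induction A k using matrix_induction_hermitian with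
      | hherm X hX =>
        refine ih _ fun l hl => ?_
        by_cases hlk : l = k
        · subst hlk; simpa using hX
        · rw [Function.update_of_ne hlk]
          exact hA l (by simp [hlk, hl])
      | hlin c X Y hX hY => exact hlin A k c X Y hX hY
  exact key Finset.univ A (by simp)

variable
  {φ : Matrix (MultiIndex n) (MultiIndex n) ℂ →ₗ[ℂ] Matrix (MultiIndex n) (MultiIndex n) ℂ}

theorem MapsProductBases.exists_tensor (hφ : MapsProductBases φ 1)
    {V : ∀ k, Matrix (Fin (n k)) (Fin (n k)) ℂ}
    (hV : ∀ k, V k ∈ Matrix.unitaryGroup (Fin (n k)) ℂ) :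
    ∃ U ∈ Matrix.unitaryGroup (MultiIndex n) ℂ, ∀ a : ∀ k, Fin (n k) → ℂ,
      φ (tensorMatrix fun k => V k * Matrix.diagonal (a k) * (V k)ᴴ) =
        U * Matrix.diagonal (fun i => ∏ k, a k (i k)) * Uᴴ := by
  obtain ⟨U, hU, h⟩ := hφ V hV
  refine ⟨U, hU, fun a => ?_⟩
  rw [← tensorMatrix_conj, tensorMatrix_diagonal, h, one_smul]

theorem MapsProductBases.mul_of_diagonal (hφ : MapsProductBases φ 1)
    {V : ∀ k, Matrix (Fin (n k)) (Fin (n k)) ℂ}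
    (hV : ∀ k, V k ∈ Matrix.unitaryGroup (Fin (n k)) ℂ) (a b : ∀ k, Fin (n k) → ℂ) :
    φ (tensorMatrix fun k => V k * Matrix.diagonal (a k) * (V k)ᴴ) *
      φ (tensorMatrix fun k => V k * Matrix.diagonal (b k) * (V k)ᴴ) =
    φ (tensorMatrix fun k => V k * Matrix.diagonal (a k * b k) * (V k)ᴴ) := by
  obtain ⟨U, hU, h⟩ := hφ.exists_tensor hV
  rw [h, h, h]
  simp only [Pi.mul_apply, Finset.prod_mul_distrib]
  rw [← Matrix.diagonal_mul_diagonal]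
  calc _ = U * Matrix.diagonal (fun i : MultiIndex n => ∏ k, a k (i k)) * (Uᴴ * U) *
        Matrix.diagonal (fun i : MultiIndex n => ∏ k, b k (i k)) * Uᴴ := by
        simp only [Matrix.mul_assoc]
    _ = _ := by
        rw [conjTranspose_mul_self_of_mem_unitaryGroup hU, Matrix.mul_one]
        simp only [Matrix.mul_assoc]

theorem MapsProductBases.conjTranspose (hφ : MapsProductBases φ 1)
    (A : ∀ k, Matrix (Fin (n k)) (Fin (n k)) ℂ) :
    (φ (tensorMatrix A))ᴴ = φ (tensorMatrix fun k => (A k)ᴴ) := by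
  induction A using tuple_induction_hermitian with
  | hherm A hA =>
    choose V hV d hd using fun k => exists_unitary_conj_diagonal (hA k)
    have h1 : (fun k => (A k)ᴴ) = A := funext fun k => hA k
    obtain ⟨U, hU, h⟩ := hφ.exists_tensor hV
    rw [h1, show A = _ from funext hd, h]
    simp only [Matrix.conjTranspose_mul, Matrix.conjTranspose_conjTranspose,
      Matrix.diagonal_conjTranspose, Matrix.mul_assoc]
    congr 3
    funext i
    simp
  | hlin A k c X Y hX hY =>
    have h : ∀ X, (fun l => (Function.update A k X l)ᴴ) =
        Function.update (fun l => (A l)ᴴ) k Xᴴ := fun X => by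
      funext l
      by_cases hl : l = k
      · subst hl; simp
      · simp [hl]
    rw [h, ← tensorSlot_apply] at hX hY ⊢
    rw [← tensorSlot_apply] at hX hY ⊢
    rw [map_add, map_add, map_smul, map_smul, Matrix.conjTranspose_add,
      Matrix.conjTranspose_smul, hX, hY, Matrix.conjTranspose_add, Matrix.conjTranspose_smul,
      map_add, map_add, map_smul, map_smul]

/-- The map induced by `φ` on the `k`-th tensor factor. -/
def factorMap
    (φ : Matrix (MultiIndex n) (MultiIndex n) ℂ →ₗ[ℂ] Matrix (MultiIndex n) (MultiIndex n) ℂ)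
    (k : Fin m) : Matrix (Fin (n k)) (Fin (n k)) ℂ →ₗ[ℂ] Matrix (MultiIndex n) (MultiIndex n) ℂ :=
  φ ∘ₗ tensorSlot (fun _ => 1) k

theorem factorMap_apply (k : Fin m) (X : Matrix (Fin (n k)) (Fin (n k)) ℂ) :
    factorMap φ k X = φ (tensorSlot (fun _ => 1) k X) := rfl

theorem tensorSlot_update_self (A : ∀ k, Matrix (Fin (n k)) (Fin (n k)) ℂ) (k : Fin m)
    (X Y : Matrix (Fin (n k)) (Fin (n k)) ℂ) :
    tensorSlot (Function.update A k X) k Y = tensorSlot A k Y := by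
  rw [tensorSlot_apply, tensorSlot_apply, Function.update_idem]

theorem tensorSlot_update_comm (A : ∀ k, Matrix (Fin (n k)) (Fin (n k)) ℂ) {k l : Fin m}
    (hkl : k ≠ l) (X : Matrix (Fin (n k)) (Fin (n k)) ℂ) (Y : Matrix (Fin (n l)) (Fin (n l)) ℂ) :
    tensorSlot (Function.update A k X) l Y = tensorSlot (Function.update A l Y) k X := by
  rw [tensorSlot_apply, tensorSlot_apply, Function.update_comm hkl]

/-- For Hermitian `A` everything is diagonal in one product basis, where `φ` is multiplicative.
Taking `A k` itself as the second argument makes the identity multilinear in the tuple. -/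
theorem MapsProductBases.mul_factorMap_self (hφ : MapsProductBases φ 1)
    (A : ∀ k, Matrix (Fin (n k)) (Fin (n k)) ℂ) (k : Fin m) :
    φ (tensorSlot A k 1) * factorMap φ k (A k) = φ (tensorMatrix A) ∧
      factorMap φ k (A k) * φ (tensorSlot A k 1) = φ (tensorMatrix A) := by
  induction A using tuple_induction_hermitian with
  | hherm A hA =>
    choose V hV d hd using fun k => exists_unitary_conj_diagonal (hA k)
    have h1 : tensorSlot A k 1 = tensorMatrix fun l => V l *
        Matrix.diagonal (Function.update (fun l a => (d l a : ℂ)) k 1 l) * (V l)ᴴ := by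
      rw [tensorSlot_apply]
      congr 1
      funext l
      by_cases hl : l = k
      · subst hl
        simp [Matrix.diagonal_one', self_mul_conjTranspose_of_mem_unitaryGroup (hV l)]
      · simpa [hl] using hd l
    have h2 : tensorSlot (fun _ => 1) k (A k) = tensorMatrix fun l => V l *
        Matrix.diagonal (Function.update (fun l (_ : Fin (n l)) => (1 : ℂ)) k
          (fun a => (d k a : ℂ)) l) * (V l)ᴴ := by
      rw [tensorSlot_apply]
      congr 1
      funext l
      by_cases hl : l = k
      · subst hl
        simpa using hd l
      · simp [hl, self_mul_conjTranspose_of_mem_unitaryGroup (hV l)]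
    have h3 : ∀ l, Function.update (fun l a => (d l a : ℂ)) k 1 l *
        Function.update (fun l (_ : Fin (n l)) => 1) k (fun a => (d k a : ℂ)) l =
        fun a => (d l a : ℂ) := fun l => by
      by_cases hl : l = k
      · subst hl; simp
      · funext a; simp [hl]
    rw [factorMap_apply, h1, h2, hφ.mul_of_diagonal hV, hφ.mul_of_diagonal hV]
    simp only [mul_comm (Function.update (fun l (_ : Fin (n l)) => (1 : ℂ)) k _ _), h3, ← hd]
    exact ⟨trivial, trivial⟩
  | hlin A l c X Y hX hY =>
    by_cases hl : l = k
    · subst hl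
      simp only [tensorSlot_update_self, Function.update_self, ← tensorSlot_apply] at hX hY ⊢
      simp only [map_add, map_smul, Matrix.mul_add, Matrix.add_mul, Matrix.mul_smul,
        Matrix.smul_mul, hX.1, hX.2, hY.1, hY.2, and_self]
    · simp only [tensorSlot_update_comm A hl, Function.update_of_ne (Ne.symm hl),
        ← tensorSlot_apply] at hX hY ⊢
      simp only [map_add, map_smul, Matrix.mul_add, Matrix.add_mul, Matrix.mul_smul,
        Matrix.smul_mul, hX.1, hX.2, hY.1, hY.2, and_self]

theorem MapsProductBases.mul_factorMap (hφ : MapsProductBases φ 1)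
    (A : ∀ k, Matrix (Fin (n k)) (Fin (n k)) ℂ) (k : Fin m)
    (X : Matrix (Fin (n k)) (Fin (n k)) ℂ) :
    φ (tensorSlot A k 1) * factorMap φ k X = φ (tensorSlot A k X) := by
  have := (hφ.mul_factorMap_self (Function.update A k X) k).1
  rwa [tensorSlot_update_self, Function.update_self, ← tensorSlot_apply] at this

theorem MapsProductBases.factorMap_mul (hφ : MapsProductBases φ 1)
    (A : ∀ k, Matrix (Fin (n k)) (Fin (n k)) ℂ) (k : Fin m)
    (X : Matrix (Fin (n k)) (Fin (n k)) ℂ) :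
    factorMap φ k X * φ (tensorSlot A k 1) = φ (tensorSlot A k X) := by
  have := (hφ.mul_factorMap_self (Function.update A k X) k).2
  rwa [tensorSlot_update_self, Function.update_self, ← tensorSlot_apply] at this

theorem tensorSlot_one_update {k l : Fin m} (hkl : k ≠ l)
    (X : Matrix (Fin (n k)) (Fin (n k)) ℂ) :
    tensorSlot (Function.update (fun l => (1 : Matrix (Fin (n l)) (Fin (n l)) ℂ)) k X) l 1 =
      tensorSlot (fun _ => 1) k X := by
  rw [tensorSlot_update_comm _ hkl]
  congr 2
  exact Function.update_eq_self l _

/-- Both products are the image of the tensor with `X` in slot `k`, `Y` in slot `l` and 1 elsewhere.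
-/
theorem MapsProductBases.factorMap_commute (hφ : MapsProductBases φ 1) {k l : Fin m} (hkl : k ≠ l)
    (X : Matrix (Fin (n k)) (Fin (n k)) ℂ) (Y : Matrix (Fin (n l)) (Fin (n l)) ℂ) :
    factorMap φ k X * factorMap φ l Y = factorMap φ l Y * factorMap φ k X := by
  have h1 := hφ.mul_factorMap (Function.update (fun _ => 1) k X) l Y
  have h2 := hφ.factorMap_mul (Function.update (fun _ => 1) k X) l Y
  rw [tensorSlot_one_update hkl] at h1 h2
  rw [factorMap_apply k, h1, h2]

/-- A linear map of matrix algebras preserving Jordan products. -/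
def PreservesJordan {ι κ : Type*} [Fintype ι] [Fintype κ] (J : Matrix ι ι ℂ →ₗ[ℂ] Matrix κ κ ℂ) : Prop :=
  ∀ X Y, J (X * Y + Y * X) = J X * J Y + J Y * J X

theorem preservesJordan_of_hermitian {ι κ : Type*} [Fintype ι] [Fintype κ]
    {J : Matrix ι ι ℂ →ₗ[ℂ] Matrix κ κ ℂ}
    (h : ∀ X : Matrix ι ι ℂ, X.IsHermitian → J (X * X) = J X * J X) : PreservesJordan J := by
  intro X Y
  induction X using matrix_induction_hermitian with
  | hherm X hX =>
    induction Y using matrix_induction_hermitian with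
    | hherm Y hY =>
      have h1 := h _ (hX.add hY)
      simp only [Matrix.add_mul, Matrix.mul_add, map_add, h X hX, h Y hY] at h1
      rw [map_add]
      rw [← sub_eq_zero] at h1 ⊢
      rw [← h1]
      abel
    | hlin c Y Z hY hZ =>
      simp only [map_add, map_smul, Matrix.mul_add, Matrix.add_mul, Matrix.mul_smul,
        Matrix.smul_mul] at hY hZ ⊢
      calc _ = (J (X * Y) + J (Y * X)) + c • (J (X * Z) + J (Z * X)) := by module
        _ = _ := by rw [hY, hZ]; module
  | hlin c X Z hX hZ =>
    simp only [map_add, map_smul, Matrix.mul_add, Matrix.add_mul, Matrix.mul_smul,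
      Matrix.smul_mul] at hX hZ ⊢
    calc _ = (J (X * Y) + J (Y * X)) + c • (J (Z * Y) + J (Y * Z)) := by module
      _ = _ := by rw [hX, hZ]; module

/-- Idempotents in the other slots make squaring the tensor square only slot `k`. The two uses take
rank-one projections and identities. -/
theorem MapsProductBases.preservesJordan_tensorSlot (hφ : MapsProductBases φ 1)
    {e : ∀ k, Fin (n k) → ℂ} (he : ∀ k a, e k a * e k a = e k a) (k : Fin m) :
    PreservesJordan (φ ∘ₗ tensorSlot (fun l => Matrix.diagonal (e l)) k) := by
  refine preservesJordan_of_hermitian fun X hX => ?_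
  obtain ⟨V, hV, d, rfl⟩ := exists_unitary_conj_diagonal hX
  have hV' := update_one_mem_unitaryGroup hV
  have h : ∀ d, tensorSlot (fun l => Matrix.diagonal (e l)) k
      (V * Matrix.diagonal d * Vᴴ) = tensorMatrix fun l =>
        Function.update (fun l => (1 : Matrix (Fin (n l)) (Fin (n l)) ℂ)) k V l *
          Matrix.diagonal (Function.update e k d l) *
          (Function.update (fun l => (1 : Matrix (Fin (n l)) (Fin (n l)) ℂ)) k V l)ᴴ := fun d => by
    rw [tensorSlot_apply]
    congr 1
    funext l
    by_cases hl : l = k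
    · subst hl; simp
    · simp [hl]
  have hmul : V * Matrix.diagonal (fun a => (d a : ℂ)) * Vᴴ *
      (V * Matrix.diagonal (fun a => (d a : ℂ)) * Vᴴ) =
      V * Matrix.diagonal (fun a => (d a : ℂ) * d a) * Vᴴ := by
    rw [← Matrix.diagonal_mul_diagonal]
    calc _ = V * Matrix.diagonal (fun a => (d a : ℂ)) * (Vᴴ * V) *
          Matrix.diagonal (fun a => (d a : ℂ)) * Vᴴ := by simp only [Matrix.mul_assoc]
      _ = _ := by
        rw [conjTranspose_mul_self_of_mem_unitaryGroup hV, Matrix.mul_one]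
        simp only [Matrix.mul_assoc]
  rw [hmul, LinearMap.comp_apply, LinearMap.comp_apply, h, h, hφ.mul_of_diagonal hV']
  congr 3
  funext l
  congr 2
  by_cases hl : l = k
  · subst hl; simp
  · congr 1
    funext a
    simp [hl, he]

theorem MapsProductBases.preservesJordan_slot (hφ : MapsProductBases φ 1) (i : MultiIndex n)
    (k : Fin m) :
    PreservesJordan (φ ∘ₗ tensorSlot (fun l => Matrix.single (i l) (i l) (1 : ℂ)) k) := by
  have := hφ.preservesJordan_tensorSlot (e := fun l => Pi.single (i l) 1)
    (fun l a => by by_cases h : a = i l <;> simp [h]) k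
  simpa only [Matrix.diagonal_single] using this

theorem MapsProductBases.preservesJordan_factorMap (hφ : MapsProductBases φ 1) (k : Fin m) :
    PreservesJordan (factorMap φ k) := by
  have := hφ.preservesJordan_tensorSlot (e := fun l => 1) (fun l a => by simp) k
  simp only [Matrix.diagonal_one'] at this
  exact this

end JordanStructure

/-! ### Jordan maps on matrix units. -/

section HomOrAntihom

theorem single_eq_smul_single_one {ι : Type*} [DecidableEq ι] (a b : ι) (x : ℂ) :
    Matrix.single a b x = x • Matrix.single a b (1 : ℂ) := by
  simp [Matrix.smul_single]

variable {ι κ : Type*} [Fintype ι] [Fintype κ] [DecidableEq ι] [DecidableEq κ]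

theorem map_mul_of_map_single_mul_single {J : Matrix ι ι ℂ →ₗ[ℂ] Matrix κ κ ℂ}
    (h : ∀ a b c d, J (Matrix.single a b 1 * Matrix.single c d 1) =
      J (Matrix.single a b 1) * J (Matrix.single c d 1)) (X Y : Matrix ι ι ℂ) :
    J (X * Y) = J X * J Y := by
  induction X using Matrix.induction_on' with
  | h_zero => simp
  | h_add X X' hX hX' => rw [Matrix.add_mul, map_add, map_add, Matrix.add_mul, hX, hX']
  | h_std_basis a b x =>
    induction Y using Matrix.induction_on' with
    | h_zero => simp
    | h_add Y Y' hY hY' => rw [Matrix.mul_add, map_add, map_add, Matrix.mul_add, hY, hY']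
    | h_std_basis c d y =>
      rw [single_eq_smul_single_one a b x, single_eq_smul_single_one c d y, Matrix.smul_mul,
        Matrix.mul_smul, map_smul, map_smul, h, map_smul, map_smul, Matrix.smul_mul,
        Matrix.mul_smul]

variable {J : Matrix ι ι ℂ →ₗ[ℂ] Matrix κ κ ℂ} {p : ι → κ}

/-- Peirce decomposition: the Jordan products of the unit at `(a, b)` with the diagonal units at `a`
and at `b` return it, which confines the image to two positions. -/
theorem PreservesJordan.map_single (hJ : PreservesJordan J) (hp : Function.Injective p)
    (hd : ∀ a, J (Matrix.single a a 1) = Matrix.single (p a) (p a) 1) {a b : ι} (hab : a ≠ b) :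
    J (Matrix.single a b 1) =
      J (Matrix.single a b 1) (p a) (p b) • Matrix.single (p a) (p b) (1 : ℂ) +
      J (Matrix.single a b 1) (p b) (p a) • Matrix.single (p b) (p a) (1 : ℂ) := by
  set X := J (Matrix.single a b 1) with hX
  have h1 : X = Matrix.diagonal (Pi.single (p a) 1) * X + X * Matrix.diagonal (Pi.single (p a) 1) := by
    have := hJ (Matrix.single a a 1) (Matrix.single a b 1)
    rwa [Matrix.single_mul_single_same, Matrix.single_mul_single_of_ne _ _ _ _ (Ne.symm hab),
      add_zero, one_mul, hd, ← Matrix.diagonal_single] at this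
  have h2 : X = Matrix.diagonal (Pi.single (p b) 1) * X + X * Matrix.diagonal (Pi.single (p b) 1) := by
    have := hJ (Matrix.single b b 1) (Matrix.single a b 1)
    rwa [Matrix.single_mul_single_same, Matrix.single_mul_single_of_ne _ _ _ _ (Ne.symm hab),
      zero_add, one_mul, hd, ← Matrix.diagonal_single] at this
  have hpab : p a ≠ p b := hp.ne hab
  ext r s
  have e1 := congrFun (congrFun h1 r) s
  have e2 := congrFun (congrFun h2 r) s
  simp only [Matrix.add_apply, Matrix.diagonal_mul, Matrix.mul_diagonal, Pi.single_apply] at e1 e2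
  simp only [Matrix.add_apply, Matrix.smul_apply, Matrix.single_apply, smul_eq_mul]
  by_cases hra : r = p a
  · subst hra
    by_cases hsb : s = p b
    · subst hsb
      simp [hpab.symm]
    · by_cases hsa : s = p a
      · subst hsa
        simp at e1
        simp [hpab.symm, e1]
      · simp [hpab, hsb] at e2
        simp [hpab.symm, Ne.symm hsb, e2]
  · by_cases hrb : r = p b
    · subst hrb
      by_cases hsa : s = p a
      · subst hsa; simp [hpab]
      · simp [hpab.symm, hsa] at e1
        simp [hpab, Ne.symm hsa, e1]
    · by_cases hsa : s = p a
      · subst hsa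
        simp [hrb, hpab] at e2
        simp [Ne.symm hra, Ne.symm hrb, e2]
      · simp [hra, hsa] at e1
        simp [Ne.symm hra, Ne.symm hrb, e1]

theorem PreservesJordan.coeff_mul_coeff (hJ : PreservesJordan J) (hp : Function.Injective p)
    (hd : ∀ a, J (Matrix.single a a 1) = Matrix.single (p a) (p a) 1) {a b : ι} (hab : a ≠ b) :
    J (Matrix.single a b 1) (p a) (p b) * J (Matrix.single a b 1) (p b) (p a) = 0 := by
  have h := hJ (Matrix.single a b 1) (Matrix.single a b 1)
  rw [Matrix.single_mul_single_of_ne _ _ _ _ (Ne.symm hab), add_zero, map_zero,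
    hJ.map_single hp hd hab] at h
  have hpab : p a ≠ p b := hp.ne hab
  simp only [Matrix.add_mul, Matrix.mul_add, Matrix.smul_mul, Matrix.mul_smul,
    Matrix.single_mul_single_same, Matrix.single_mul_single_of_ne _ _ _ _ hpab,
    Matrix.single_mul_single_of_ne _ _ _ _ hpab.symm, smul_zero, zero_add, add_zero] at h
  have h' := congrFun (congrFun h (p a)) (p a)
  simp [hpab.symm] at h'
  have h3 : (2 : ℂ) * (J (Matrix.single a b 1) (p a) (p b) *
    J (Matrix.single a b 1) (p b) (p a)) = 0 := by linear_combination -h'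
  simpa using h3

theorem PreservesJordan.coeff_mul_coeff_swap (hJ : PreservesJordan J) (hp : Function.Injective p)
    (hd : ∀ a, J (Matrix.single a a 1) = Matrix.single (p a) (p a) 1) {a b : ι} (hab : a ≠ b) :
    J (Matrix.single a b 1) (p a) (p b) * J (Matrix.single b a 1) (p b) (p a) +
      J (Matrix.single a b 1) (p b) (p a) * J (Matrix.single b a 1) (p a) (p b) = 1 := by
  have h := hJ (Matrix.single a b 1) (Matrix.single b a 1)
  rw [Matrix.single_mul_single_same, Matrix.single_mul_single_same, map_add, one_mul, hd, hd,
    hJ.map_single hp hd hab, hJ.map_single hp hd hab.symm] at h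
  have hpab : p a ≠ p b := hp.ne hab
  simp only [Matrix.add_mul, Matrix.mul_add, Matrix.smul_mul, Matrix.mul_smul,
    Matrix.single_mul_single_same, Matrix.single_mul_single_of_ne _ _ _ _ hpab,
    Matrix.single_mul_single_of_ne _ _ _ _ hpab.symm, smul_zero, zero_add, add_zero] at h
  have h' := congrFun (congrFun h (p a)) (p a)
  simp [hpab.symm] at h'
  linear_combination -h'

theorem PreservesJordan.coeff_trans (hJ : PreservesJordan J) (hp : Function.Injective p)
    (hd : ∀ a, J (Matrix.single a a 1) = Matrix.single (p a) (p a) 1) {a b c : ι} (hab : a ≠ b)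
    (hbc : b ≠ c) (hac : a ≠ c) :
    J (Matrix.single a c 1) (p a) (p c) =
      J (Matrix.single a b 1) (p a) (p b) * J (Matrix.single b c 1) (p b) (p c) := by
  have h := hJ (Matrix.single a b 1) (Matrix.single b c 1)
  rw [Matrix.single_mul_single_same, Matrix.single_mul_single_of_ne _ _ _ _ hac.symm,
    add_zero, one_mul, hJ.map_single hp hd hab, hJ.map_single hp hd hbc] at h
  have hpab : p a ≠ p b := hp.ne hab
  have hpbc : p b ≠ p c := hp.ne hbc
  have hpac : p a ≠ p c := hp.ne hac
  simp only [Matrix.add_mul, Matrix.mul_add, Matrix.smul_mul, Matrix.mul_smul,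
    Matrix.single_mul_single_same, Matrix.single_mul_single_of_ne _ _ _ _ hpab,
    Matrix.single_mul_single_of_ne _ _ _ _ hpab.symm, Matrix.single_mul_single_of_ne _ _ _ _ hpbc,
    Matrix.single_mul_single_of_ne _ _ _ _ hpbc.symm, Matrix.single_mul_single_of_ne _ _ _ _ hpac,
    Matrix.single_mul_single_of_ne _ _ _ _ hpac.symm, smul_zero, zero_add, add_zero] at h
  have h' := congrFun (congrFun h (p a)) (p c)
  simp [hpac.symm] at h'
  exact h'.trans (mul_comm _ _)

theorem PreservesJordan.map_mul_of_coeff_eq_zero (hJ : PreservesJordan J)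
    (hp : Function.Injective p)
    (hd : ∀ a, J (Matrix.single a a 1) = Matrix.single (p a) (p a) 1)
    (h0 : ∀ a b, a ≠ b → J (Matrix.single a b 1) (p b) (p a) = 0) (X Y : Matrix ι ι ℂ) :
    J (X * Y) = J X * J Y := by
  have hs : ∀ a b, J (Matrix.single a b 1) =
      J (Matrix.single a b 1) (p a) (p b) • Matrix.single (p a) (p b) (1 : ℂ) := fun a b => by
    by_cases hab : a = b
    · subst hab; simp [hd]
    · conv_lhs => rw [hJ.map_single hp hd hab]
      rw [h0 a b hab, zero_smul, add_zero]
  have hmul : ∀ a b c, J (Matrix.single a c 1) (p a) (p c) =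
      J (Matrix.single a b 1) (p a) (p b) * J (Matrix.single b c 1) (p b) (p c) := fun a b c => by
    by_cases hab : a = b
    · subst hab; simp [hd]
    · by_cases hbc : b = c
      · subst hbc; simp [hd]
      · by_cases hac : a = c
        · subst hac
          have := hJ.coeff_mul_coeff_swap hp hd hab
          rw [h0 a b hab, zero_mul, add_zero] at this
          rw [this, hd, Matrix.single_apply_same]
        · exact hJ.coeff_trans hp hd hab hbc hac
  refine map_mul_of_map_single_mul_single (fun a b c d => ?_) X Y
  by_cases hbc : b = c
  · subst hbc
    rw [Matrix.single_mul_single_same, one_mul, hs a d, hs a b, hs b d]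
    simp [hmul a b d, Matrix.smul_single]
  · rw [Matrix.single_mul_single_of_ne _ _ _ _ hbc, map_zero, hs a b, hs c d, Matrix.smul_mul,
      Matrix.mul_smul, Matrix.single_mul_single_of_ne _ _ _ _ (hp.ne hbc), smul_zero, smul_zero]

omit [DecidableEq ι] [DecidableEq κ] in
theorem PreservesJordan.comp_transpose (hJ : PreservesJordan J) :
    PreservesJordan (J ∘ₗ (Matrix.transposeLinearEquiv ι ι ℂ ℂ).toLinearMap) := fun X Y => by
  change J (X * Y + Y * X)ᵀ = J Xᵀ * J Yᵀ + J Yᵀ * J Xᵀ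
  rw [Matrix.transpose_add, Matrix.transpose_mul, Matrix.transpose_mul, add_comm, hJ]

/-- A Jordan map carrying the diagonal matrix units to diagonal matrix units is multiplicative or
anti-multiplicative. -/
theorem PreservesJordan.mul_or_mul_swap (hJ : PreservesJordan J) (hp : Function.Injective p)
    (hd : ∀ a, J (Matrix.single a a 1) = Matrix.single (p a) (p a) 1) :
    (∀ X Y, J (X * Y) = J X * J Y) ∨ ∀ X Y, J (X * Y) = J Y * J X := by
  by_cases h : ∀ a b, a ≠ b → J (Matrix.single a b 1) (p b) (p a) = 0
  · exact Or.inl (hJ.map_mul_of_coeff_eq_zero hp hd h)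
  right
  -- One vanishing forward coefficient spreads to the reversed pair and to all pairs with the same
  -- first index, hence everywhere; precomposing with transposition then reduces to the
  -- multiplicative case.
  have hsymm : ∀ a b, a ≠ b → J (Matrix.single a b 1) (p a) (p b) = 0 →
      J (Matrix.single b a 1) (p b) (p a) = 0 := fun a b hab h0 => by
    have h1 := hJ.coeff_mul_coeff_swap hp hd hab
    rw [h0, zero_mul, zero_add] at h1
    have h2 := hJ.coeff_mul_coeff hp hd (Ne.symm hab)
    exact (mul_eq_zero.1 h2).resolve_right fun h3 => by rw [h3, mul_zero] at h1; simp at h1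
  have hright : ∀ a b c, a ≠ b → a ≠ c → J (Matrix.single a b 1) (p a) (p b) = 0 →
      J (Matrix.single a c 1) (p a) (p c) = 0 := fun a b c hab hac h0 => by
    by_cases hbc : b = c
    · subst hbc; exact h0
    · rw [hJ.coeff_trans hp hd hab hbc hac, h0, zero_mul]
  have hzero : ∀ c d, c ≠ d → J (Matrix.single c d 1) (p c) (p d) = 0 := by
    push Not at h
    obtain ⟨a, b, hab, hb⟩ := h
    have h0 := (mul_eq_zero.1 (hJ.coeff_mul_coeff hp hd hab)).resolve_right hb
    intro c d hcd
    by_cases hca : c = a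
    · subst hca
      exact hright c b d hab hcd h0
    · exact hright c a d hca hcd (hsymm a c (Ne.symm hca) (hright a b c hab (Ne.symm hca) h0))
  intro X Y
  have := hJ.comp_transpose.map_mul_of_coeff_eq_zero hp (fun a => by simp [hd])
    (fun a b hab => by
      simpa [Matrix.transpose_single] using hzero b a (Ne.symm hab)) Yᵀ Xᵀ
  simpa using this

end HomOrAntihom

/-! ### Each factor map is multiplicative or anti-multiplicative. -/

section FactorType

variable {m : ℕ} {n : Fin m → ℕ}
  {φ : Matrix (MultiIndex n) (MultiIndex n) ℂ →ₗ[ℂ] Matrix (MultiIndex n) (MultiIndex n) ℂ}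

/-- The left annihilated elements form a Jordan ideal of a matrix algebra, so they contain the
identity as soon as they contain a diagonal matrix unit. -/
theorem MapsProductBases.mul_tensorSlot_one_eq_zero (hφ : MapsProductBases φ 1) {l : Fin m}
    {H : Matrix (MultiIndex n) (MultiIndex n) ℂ}
    (hH : ∀ Z, H * factorMap φ l Z = factorMap φ l Z * H)
    (B : ∀ k, Matrix (Fin (n k)) (Fin (n k)) ℂ) (c : Fin (n l))
    (h : H * φ (tensorSlot B l (Matrix.single c c 1)) = 0) : H * φ (tensorSlot B l 1) = 0 := by
  have hJ : ∀ Z W, H * φ (tensorSlot B l Z) = 0 → H * φ (tensorSlot B l (Z * W + W * Z)) = 0 :=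
    fun Z W hZ => by
      have e : φ (tensorSlot B l (Z * W + W * Z)) =
          φ (tensorSlot B l Z) * factorMap φ l W + factorMap φ l W * φ (tensorSlot B l Z) := by
        rw [← hφ.mul_factorMap, hφ.preservesJordan_factorMap l, Matrix.mul_add,
          ← Matrix.mul_assoc, ← Matrix.mul_assoc, hφ.mul_factorMap, hφ.mul_factorMap,
          ← hφ.factorMap_mul B l W, Matrix.mul_assoc (factorMap φ l W), hφ.mul_factorMap]
      rw [e, Matrix.mul_add, ← Matrix.mul_assoc, ← Matrix.mul_assoc, hZ, hH, Matrix.mul_assoc _ H,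
        hZ, Matrix.zero_mul, Matrix.mul_zero, add_zero]
  have hdiag : ∀ a, H * φ (tensorSlot B l (Matrix.single a a 1)) = 0 := fun a => by
    by_cases hac : a = c
    · subst hac; exact h
    -- The Jordan ideal passes from the unit at `(c, c)` to that at `(c, a)`, then to the sum of
    -- those at `(c, c)` and `(a, a)`.
    · have h1 := hJ _ (Matrix.single c a 1) h
      rw [Matrix.single_mul_single_same, Matrix.single_mul_single_of_ne _ _ _ _ hac, add_zero,
        one_mul] at h1
      have h2 := hJ _ (Matrix.single a c 1) h1
      rwa [Matrix.single_mul_single_same, Matrix.single_mul_single_same, one_mul, map_add, map_add,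
        Matrix.mul_add, h, zero_add] at h2
  rw [← Matrix.diagonal_one, ← Matrix.sum_single_eq_diagonal, map_sum, map_sum, Finset.mul_sum]
  exact Finset.sum_eq_zero fun a _ => hdiag a

/-- The rank-one projections are replaced by 1 one slot at a time, until `H * φ 1 = 0`. -/
theorem MapsProductBases.eq_zero_of_mul_slot_eq_zero (hφ : MapsProductBases φ 1)
    (hone : φ 1 = 1) {k : Fin m} {H : Matrix (MultiIndex n) (MultiIndex n) ℂ}
    (hH : ∀ l, l ≠ k → ∀ Z, H * factorMap φ l Z = factorMap φ l Z * H) (i : MultiIndex n)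
    (h : H * φ (tensorSlot (fun l => Matrix.single (i l) (i l) (1 : ℂ)) k 1) = 0) : H = 0 := by
  have key : ∀ s : Finset (Fin m), H * φ (tensorSlot
      (s.piecewise (fun _ => 1) fun l => Matrix.single (i l) (i l) (1 : ℂ)) k 1) = 0 := fun s => by
    induction s using Finset.induction_on with
    | empty => simpa using h
    | insert l s hl ih =>
      rw [Finset.piecewise_insert]
      by_cases hlk : l = k
      · subst hlk
        rwa [tensorSlot_update_self]
      · rw [tensorSlot_update_comm _ hlk]
        refine hφ.mul_tensorSlot_one_eq_zero (hH l hlk) _ (i l) ?_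
        rw [← tensorSlot_update_comm _ hlk, ← Finset.piecewise_eq_of_notMem s (fun l =>
          (1 : Matrix (Fin (n l)) (Fin (n l)) ℂ)) (fun l => Matrix.single (i l) (i l) (1 : ℂ)) hl,
          Function.update_eq_self]
        exact ih
  have := key Finset.univ
  rw [Finset.piecewise_univ, tensorSlot_apply, Function.update_eq_self k (fun l =>
    (1 : Matrix (Fin (n l)) (Fin (n l)) ℂ)), tensorMatrix_one, hone, Matrix.mul_one] at this
  exact this

/-- The corner map `J` has a definite type. The defect of that type for `factorMap φ k` commutes
with the other factor maps, and its product with `J 1` is the defect of `J`, namely 0; so it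
vanishes. -/
theorem MapsProductBases.factorMap_mul_or_mul_swap (hφ : MapsProductBases φ 1)
    (hdiag : ∀ d, φ (Matrix.diagonal d) = Matrix.diagonal d) (i : MultiIndex n) (k : Fin m) :
    (∀ X Y, factorMap φ k (X * Y) = factorMap φ k X * factorMap φ k Y) ∨
      ∀ X Y, factorMap φ k (X * Y) = factorMap φ k Y * factorMap φ k X := by
  set J := φ ∘ₗ tensorSlot (fun l => Matrix.single (i l) (i l) (1 : ℂ)) k with hJ
  have hone : φ 1 = 1 := by simpa using hdiag 1
  have hd : ∀ a, J (Matrix.single a a 1) =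
      Matrix.single (Function.update i k a) (Function.update i k a) 1 := fun a => by
    have h : Function.update (fun l => Matrix.single (i l) (i l) (1 : ℂ)) k (Matrix.single a a 1) =
        fun l => Matrix.single (Function.update i k a l) (Function.update i k a l) 1 := by
      funext l
      by_cases hl : l = k
      · subst hl; simp
      · simp [hl]
    rw [hJ, LinearMap.comp_apply, tensorSlot_apply, h, tensorMatrix_single,
      ← Matrix.diagonal_single, hdiag]
  have hJ1 : ∀ X, J X = factorMap φ k X * J 1 := fun X => (hφ.factorMap_mul _ k X).symm
  have hJ2 : ∀ X, J X = J 1 * factorMap φ k X := fun X => (hφ.mul_factorMap _ k X).symm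
  have hcomm : ∀ X Y l, l ≠ k → ∀ Z, factorMap φ k X * factorMap φ k Y * factorMap φ l Z =
      factorMap φ l Z * (factorMap φ k X * factorMap φ k Y) := fun X Y l hl Z => by
    rw [Matrix.mul_assoc, hφ.factorMap_commute hl.symm, ← Matrix.mul_assoc,
      hφ.factorMap_commute hl.symm, Matrix.mul_assoc]
  have hmul : J 1 = J 1 * J 1 → ∀ X Y, J X * J Y = factorMap φ k X * factorMap φ k Y * J 1 :=
    fun h X Y => by
      calc J X * J Y = factorMap φ k X * (J 1 * factorMap φ k Y) * J 1 := by
            rw [hJ1 X, hJ1 Y]; simp only [Matrix.mul_assoc]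
        _ = factorMap φ k X * (factorMap φ k Y * J 1) * J 1 := by rw [← hJ2, ← hJ1]
        _ = factorMap φ k X * factorMap φ k Y * (J 1 * J 1) := by simp only [Matrix.mul_assoc]
        _ = _ := by rw [← h]
  rcases (hφ.preservesJordan_slot i k).mul_or_mul_swap (Function.update_injective i k) hd with h | h
  · left
    intro X Y
    have hJ11 : J (1 * 1) = J 1 * J 1 := h 1 1
    rw [mul_one] at hJ11
    rw [← sub_eq_zero]
    refine hφ.eq_zero_of_mul_slot_eq_zero hone (k := k) (fun l hl Z => ?_) i ?_
    · rw [Matrix.sub_mul, Matrix.mul_sub, hcomm X Y l hl, hφ.factorMap_commute hl.symm]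
    · have h1 := hmul hJ11 X Y
      have h2 := h X Y
      change J (X * Y) = J X * J Y at h2
      change _ * J 1 = 0
      rw [Matrix.sub_mul, ← hJ1, h2, h1, sub_self]
  · right
    intro X Y
    have hJ11 : J (1 * 1) = J 1 * J 1 := h 1 1
    rw [mul_one] at hJ11
    rw [← sub_eq_zero]
    refine hφ.eq_zero_of_mul_slot_eq_zero hone (k := k) (fun l hl Z => ?_) i ?_
    · rw [Matrix.sub_mul, Matrix.mul_sub, hcomm Y X l hl, hφ.factorMap_commute hl.symm]
    · have h1 := hmul hJ11 Y X
      have h2 := h X Y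
      change J (X * Y) = J Y * J X at h2
      change _ * J 1 = 0
      rw [Matrix.sub_mul, ← hJ1, h2, h1, sub_self]

end FactorType

/-! ### Recovering the unitary and the transposed factors. -/

section Reconstruction

/-- A `*`-endomorphism of a matrix algebra fixing the diagonal matrix units is conjugation by a
unitary matrix. -/
theorem exists_unitary_conj_of_map_mul {ι : Type*} [Fintype ι] [DecidableEq ι]
    {Ψ : Matrix ι ι ℂ →ₗ[ℂ] Matrix ι ι ℂ} (hmul : ∀ X Y, Ψ (X * Y) = Ψ X * Ψ Y)
    (hstar : ∀ i j, (Ψ (Matrix.single i j 1))ᴴ = Ψ (Matrix.single j i 1))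
    (hdiag : ∀ i, Ψ (Matrix.single i i 1) = Matrix.single i i 1) :
    ∃ U ∈ Matrix.unitaryGroup ι ℂ, ∀ X, Ψ X = U * X * Uᴴ := by
  rcases isEmpty_or_nonempty ι with he | ⟨⟨o⟩⟩
  · exact ⟨1, one_mem _, fun X => by ext i; exact he.elim i⟩
  have hc : ∀ i j, Ψ (Matrix.single i j 1) = Matrix.single i j (Ψ (Matrix.single i j 1) i j) :=
    fun i j => by
      have h : Matrix.single i j (1 : ℂ) =
          Matrix.single i i 1 * Matrix.single i j 1 * Matrix.single j j 1 := by simp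
      conv_lhs => rw [h, hmul, hmul, hdiag, hdiag]
      simp
  have htrans : ∀ i j k, Ψ (Matrix.single i j 1) i j * Ψ (Matrix.single j k 1) j k =
      Ψ (Matrix.single i k 1) i k := fun i j k => by
    have h := hmul (Matrix.single i j 1) (Matrix.single j k 1)
    rw [Matrix.single_mul_single_same, one_mul, hc i j, hc j k,
      Matrix.single_mul_single_same] at h
    rw [h, Matrix.single_apply_same]
  have hst : ∀ i j, star (Ψ (Matrix.single i j 1) i j) = Ψ (Matrix.single j i 1) j i :=
    fun i j => by rw [← hstar i j, Matrix.conjTranspose_apply]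
  -- The coefficients of the images of matrix units form a unimodular cocycle, trivialised by the
  -- fixed index `o`.
  have hUU : Matrix.diagonal (fun i => Ψ (Matrix.single i o 1) i o) *
      (Matrix.diagonal fun i => Ψ (Matrix.single i o 1) i o)ᴴ = 1 := by
    rw [Matrix.diagonal_conjTranspose, Matrix.diagonal_mul_diagonal, ← Matrix.diagonal_one]
    congr 1
    funext i
    rw [Pi.star_apply, hst, htrans, hdiag, Matrix.single_apply_same]
  refine ⟨_, Matrix.mem_unitaryGroup_iff.2 hUU, fun X => ?_⟩
  induction X using Matrix.induction_on' with
  | h_zero => simp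
  | h_add X Y hX hY => rw [map_add, hX, hY, Matrix.mul_add, Matrix.add_mul]
  | h_std_basis i j x =>
    rw [single_eq_smul_single_one, map_smul, hc i j, ← htrans i o j, ← hst j o]
    ext p q
    simp only [Matrix.smul_apply, Matrix.diagonal_conjTranspose, Matrix.mul_diagonal,
      Matrix.diagonal_mul, Matrix.single_apply, smul_eq_mul, Pi.star_apply]
    split_ifs with h
    · rw [← h.1, ← h.2]; ring
    · simp

variable {m : ℕ} {n : Fin m → ℕ}

/-- Induction on the slots where `B` may differ from 1: in slot `k` the two adjacent factor images
multiply, moving `B k` into `A`. -/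
theorem map_tensorMatrix_mul
    {Ψ : Matrix (MultiIndex n) (MultiIndex n) ℂ →ₗ[ℂ] Matrix (MultiIndex n) (MultiIndex n) ℂ}
    (hone : Ψ 1 = 1)
    (hright : ∀ A k X, Ψ (tensorSlot A k 1) * factorMap Ψ k X = Ψ (tensorSlot A k X))
    (hleft : ∀ A k X, factorMap Ψ k X * Ψ (tensorSlot A k 1) = Ψ (tensorSlot A k X))
    (hmul : ∀ k X Y, factorMap Ψ k (X * Y) = factorMap Ψ k X * factorMap Ψ k Y)
    (A B : ∀ k, Matrix (Fin (n k)) (Fin (n k)) ℂ) :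
    Ψ (tensorMatrix A) * Ψ (tensorMatrix B) = Ψ (tensorMatrix fun k => A k * B k) := by
  have key : ∀ s : Finset (Fin m), ∀ A B : ∀ k, Matrix (Fin (n k)) (Fin (n k)) ℂ,
      (∀ k, k ∉ s → B k = 1) →
      Ψ (tensorMatrix A) * Ψ (tensorMatrix B) = Ψ (tensorMatrix fun k => A k * B k) := fun s => by
    induction s using Finset.induction_on with
    | empty =>
      intro A B hB
      rw [show B = fun _ => 1 from funext fun k => hB k (by simp), tensorMatrix_one, hone]
      simp
    | insert k s _ ih =>
      intro A B hB
      have h1 : Ψ (tensorMatrix B) = factorMap Ψ k (B k) * Ψ (tensorSlot B k 1) := by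
        rw [hleft, tensorSlot_apply, Function.update_eq_self]
      have h2 : Ψ (tensorMatrix A) = Ψ (tensorSlot A k 1) * factorMap Ψ k (A k) := by
        rw [hright, tensorSlot_apply, Function.update_eq_self]
      rw [h1, h2, ← Matrix.mul_assoc, Matrix.mul_assoc (Ψ (tensorSlot A k 1)), ← hmul, hright,
        tensorSlot_apply, tensorSlot_apply, ih]
      · congr 2
        funext l
        by_cases hl : l = k
        · subst hl; simp
        · simp [hl]
      · intro l hl
        by_cases hlk : l = k
        · subst hlk; simp
        · rw [Function.update_of_ne hlk]
          exact hB l (by simp [hlk, hl])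
  exact key Finset.univ A B (by simp)

/-- Transposition in the factors belonging to `s`. -/
def transposeOn (s : Finset (Fin m)) (k : Fin m) (X : Matrix (Fin (n k)) (Fin (n k)) ℂ) :
    Matrix (Fin (n k)) (Fin (n k)) ℂ :=
  if k ∈ s then Xᵀ else X

theorem transposeOn_transposeOn (s : Finset (Fin m)) (k : Fin m)
    (X : Matrix (Fin (n k)) (Fin (n k)) ℂ) : transposeOn s k (transposeOn s k X) = X := by
  simp only [transposeOn]
  split_ifs <;> simp

theorem transposeOn_one (s : Finset (Fin m)) (k : Fin m) :
    transposeOn s k (1 : Matrix (Fin (n k)) (Fin (n k)) ℂ) = 1 := by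
  simp only [transposeOn]
  split_ifs <;> simp

theorem transposeOn_conjTranspose (s : Finset (Fin m)) (k : Fin m)
    (X : Matrix (Fin (n k)) (Fin (n k)) ℂ) : (transposeOn s k X)ᴴ = transposeOn s k Xᴴ := by
  simp only [transposeOn]
  split_ifs
  · rfl
  · rfl

/-- The partial transposition of the tensor factors belonging to `s`. -/
def partialTranspose (s : Finset (Fin m)) :
    Matrix (MultiIndex n) (MultiIndex n) ℂ →ₗ[ℂ] Matrix (MultiIndex n) (MultiIndex n) ℂ where
  toFun X := Matrix.of fun i j => X (s.piecewise j i) (s.piecewise i j)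
  map_add' _ _ := rfl
  map_smul' _ _ := rfl

theorem partialTranspose_tensorMatrix (s : Finset (Fin m))
    (A : ∀ k, Matrix (Fin (n k)) (Fin (n k)) ℂ) :
    partialTranspose s (tensorMatrix A) = tensorMatrix fun k => transposeOn s k (A k) := by
  ext i j
  change ∏ k, A k (s.piecewise j i k) (s.piecewise i j k) = ∏ k, transposeOn s k (A k) (i k) (j k)
  refine Finset.prod_congr rfl fun k _ => ?_
  by_cases hk : k ∈ s <;> simp [transposeOn, hk]

theorem partialTranspose_tensorSlot (s : Finset (Fin m))
    (A : ∀ k, Matrix (Fin (n k)) (Fin (n k)) ℂ) (k : Fin m)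
    (X : Matrix (Fin (n k)) (Fin (n k)) ℂ) :
    partialTranspose s (tensorSlot A k X) =
      tensorSlot (fun l => transposeOn s l (A l)) k (transposeOn s k X) := by
  rw [tensorSlot_apply, partialTranspose_tensorMatrix, tensorSlot_apply]
  congr 1
  funext l
  by_cases hl : l = k
  · subst hl; simp
  · simp [hl]

variable
  {φ : Matrix (MultiIndex n) (MultiIndex n) ℂ →ₗ[ℂ] Matrix (MultiIndex n) (MultiIndex n) ℂ}

theorem factorMap_comp_partialTranspose (s : Finset (Fin m)) (k : Fin m)
    (X : Matrix (Fin (n k)) (Fin (n k)) ℂ) :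
    factorMap (φ ∘ₗ partialTranspose s) k X = factorMap φ k (transposeOn s k X) := by
  rw [factorMap_apply, LinearMap.comp_apply, partialTranspose_tensorSlot]
  simp only [transposeOn_one]
  rfl

theorem MapsProductBases.exists_partialTranspose_conj (hφ : MapsProductBases φ 1)
    (hdiag : ∀ d, φ (Matrix.diagonal d) = Matrix.diagonal d) (o : MultiIndex n) :
    ∃ s : Finset (Fin m), ∃ U ∈ Matrix.unitaryGroup (MultiIndex n) ℂ,
      ∀ A, φ (tensorMatrix A) = U * tensorMatrix (fun k => transposeOn s k (A k)) * Uᴴ := by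
  classical
  -- The factors that must be transposed: their maps fail to be multiplicative, so they are
  -- anti-multiplicative.
  let s : Finset (Fin m) := Finset.univ.filter fun k =>
    ¬ ∀ X Y, factorMap φ k (X * Y) = factorMap φ k X * factorMap φ k Y
  set Ψ := φ ∘ₗ partialTranspose s with hΨ
  have hone : Ψ 1 = 1 := by
    rw [hΨ, LinearMap.comp_apply, ← tensorMatrix_one, partialTranspose_tensorMatrix]
    simp only [transposeOn_one]
    rw [tensorMatrix_one]
    simpa using hdiag 1
  have hright : ∀ A k X, Ψ (tensorSlot A k 1) * factorMap Ψ k X = Ψ (tensorSlot A k X) :=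
    fun A k X => by
      rw [factorMap_comp_partialTranspose, hΨ, LinearMap.comp_apply, LinearMap.comp_apply,
        partialTranspose_tensorSlot, partialTranspose_tensorSlot, transposeOn_one,
        hφ.mul_factorMap]
  have hleft : ∀ A k X, factorMap Ψ k X * Ψ (tensorSlot A k 1) = Ψ (tensorSlot A k X) :=
    fun A k X => by
      rw [factorMap_comp_partialTranspose, hΨ, LinearMap.comp_apply, LinearMap.comp_apply,
        partialTranspose_tensorSlot, partialTranspose_tensorSlot, transposeOn_one,
        hφ.factorMap_mul]
  have hmul : ∀ k X Y, factorMap Ψ k (X * Y) = factorMap Ψ k X * factorMap Ψ k Y := fun k X Y => by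
    simp only [hΨ, factorMap_comp_partialTranspose, transposeOn]
    by_cases hk : ∀ X Y, factorMap φ k (X * Y) = factorMap φ k X * factorMap φ k Y
    · have : k ∉ s := by simpa [s] using hk
      simp only [if_neg this, hk]
    · have : k ∈ s := by simpa [s] using hk
      simp only [if_pos this, Matrix.transpose_mul]
      exact ((hφ.factorMap_mul_or_mul_swap hdiag o k).resolve_left hk) _ _
  have htensor := map_tensorMatrix_mul hone hright hleft hmul
  obtain ⟨U, hU, h⟩ := exists_unitary_conj_of_map_mul (Ψ := Ψ)
    (map_mul_of_map_single_mul_single fun a b c d => by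
      rw [← tensorMatrix_single a b, ← tensorMatrix_single c d, htensor, tensorMatrix_mul])
    (fun i j => by
      rw [← tensorMatrix_single, ← tensorMatrix_single j i, hΨ, LinearMap.comp_apply,
        LinearMap.comp_apply, partialTranspose_tensorMatrix, partialTranspose_tensorMatrix,
        hφ.conjTranspose]
      simp only [transposeOn_conjTranspose, Matrix.conjTranspose_single, star_one])
    (fun i => by
      rw [← tensorMatrix_single, hΨ, LinearMap.comp_apply, partialTranspose_tensorMatrix]
      have : ∀ k, transposeOn s k (Matrix.single (i k) (i k) (1 : ℂ)) =
          Matrix.single (i k) (i k) 1 := fun k => by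
        simp only [transposeOn]
        split_ifs <;> simp
      simp only [this]
      rw [tensorMatrix_single, ← Matrix.diagonal_single, hdiag])
  refine ⟨s, U, hU, fun A => ?_⟩
  rw [← h, hΨ, LinearMap.comp_apply, partialTranspose_tensorMatrix]
  simp only [transposeOn_transposeOn]

theorem PreservesRadius.exists_partialTranspose_conj (hφ : PreservesRadius φ)
    (o : MultiIndex n) :
    ∃ U ∈ Matrix.unitaryGroup (MultiIndex n) ℂ, ∃ ξ : ℂ, ‖ξ‖ = 1 ∧ ∃ s : Finset (Fin m),
      ∀ A, φ (tensorMatrix A) =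
        ξ • (U * tensorMatrix (fun k => transposeOn s k (A k)) * Uᴴ) := by
  obtain ⟨ξ, hξ, h⟩ := hφ.mapsProductBases
  have hξ0 : ξ ≠ 0 := fun h0 => by rw [h0] at hξ; simp at hξ
  obtain ⟨W, hW, hd⟩ := h (fun _ => 1) fun _ => one_mem _
  simp only [tensorMatrix_one, Matrix.one_mul, Matrix.conjTranspose_one, Matrix.mul_one] at hd
  have hWW := conjTranspose_mul_self_of_mem_unitaryGroup hW
  have hWW' := self_mul_conjTranspose_of_mem_unitaryGroup hW
  have hcancel : ∀ X : Matrix (MultiIndex n) (MultiIndex n) ℂ, Wᴴ * (W * X * Wᴴ) * W = X :=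
    fun X => by
      calc _ = (Wᴴ * W) * X * (Wᴴ * W) := by simp only [Matrix.mul_assoc]
        _ = X := by rw [hWW, Matrix.one_mul, Matrix.mul_one]
  -- Normalised so that `χ` fixes every diagonal matrix.
  let χ := ξ⁻¹ • (conjLinear Wᴴ ∘ₗ φ)
  have hχ : ∀ X, χ X = ξ⁻¹ • (Wᴴ * φ X * W) := fun X => by
    change ξ⁻¹ • (Wᴴ * φ X * Wᴴᴴ) = _
    rw [Matrix.conjTranspose_conjTranspose]
  have hφχ : ∀ X, φ X = ξ • (W * χ X * Wᴴ) := fun X => by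
    rw [hχ, Matrix.mul_smul, Matrix.smul_mul, smul_smul, mul_inv_cancel₀ hξ0, one_smul]
    calc _ = (W * Wᴴ) * φ X * (W * Wᴴ) := by rw [hWW', Matrix.one_mul, Matrix.mul_one]
      _ = _ := by simp only [Matrix.mul_assoc]
  have hmaps : MapsProductBases χ 1 := fun V hV => by
    obtain ⟨U, hU, hVU⟩ := h V hV
    refine ⟨Wᴴ * U, mul_mem (Unitary.star_mem hW) hU, fun d => ?_⟩
    rw [hχ, hVU, Matrix.mul_smul, Matrix.smul_mul, smul_smul, inv_mul_cancel₀ hξ0,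
      Matrix.conjTranspose_mul, Matrix.conjTranspose_conjTranspose]
    simp only [Matrix.mul_assoc]
  obtain ⟨s, U, hU, hs⟩ := hmaps.exists_partialTranspose_conj (fun d => by
    rw [hχ, hd, Matrix.mul_smul, Matrix.smul_mul, smul_smul, inv_mul_cancel₀ hξ0, one_smul,
      hcancel]) o
  refine ⟨W * U, mul_mem hW hU, ξ, hξ, s, fun A => ?_⟩
  rw [hφχ, hs, Matrix.conjTranspose_mul]
  simp only [Matrix.mul_assoc]

end Reconstruction

/-! ### Mixed types on factors of size at least 3 are impossible. -/

section TypeObstruction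

/-- The weighted shift with weights `1, 2` in the upper left corner. -/
def weightedShift (N : ℕ) : Matrix (Fin N) (Fin N) ℂ :=
  Matrix.of fun a b => if (a : ℕ) = 0 ∧ (b : ℕ) = 1 then 1 else
    if (a : ℕ) = 1 ∧ (b : ℕ) = 2 then 2 else 0

/-- The diagonal matrix unit in the upper left corner. -/
def cornerUnit (N : ℕ) : Matrix (Fin N) (Fin N) ℂ :=
  Matrix.of fun a b => if (a : ℕ) = 0 ∧ (b : ℕ) = 0 then 1 else 0

theorem cornerUnit_transpose (N : ℕ) : (cornerUnit N)ᵀ = cornerUnit N := by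
  ext a b
  simp [cornerUnit, and_comm]

theorem sum_norm_weightedShift_row {N : ℕ} (hN : 3 ≤ N) (a : Fin N) :
    ∑ b, ‖weightedShift N a b‖ = if (a : ℕ) = 0 then 1 else if (a : ℕ) = 1 then 2 else 0 := by
  obtain ⟨N, rfl⟩ := Nat.exists_eq_add_of_le' hN
  have h2 : 2 % (N + 3) = 2 := Nat.mod_eq_of_lt (by omega)
  simp only [weightedShift, Matrix.of_apply, Fin.sum_univ_succ]
  by_cases h0 : (a : ℕ) = 0
  · simp [h0, h2]
  · by_cases h1 : (a : ℕ) = 1 <;> simp [h0, h1]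

theorem sum_norm_weightedShift_col {N : ℕ} (hN : 3 ≤ N) (a : Fin N) :
    ∑ b, ‖weightedShift N b a‖ = if (a : ℕ) = 1 then 1 else if (a : ℕ) = 2 then 2 else 0 := by
  obtain ⟨N, rfl⟩ := Nat.exists_eq_add_of_le' hN
  have h2 : 2 % (N + 3) = 2 := Nat.mod_eq_of_lt (by omega)
  simp only [weightedShift, Matrix.of_apply, Fin.sum_univ_succ]
  by_cases h0 : (a : ℕ) = 1
  · simp [h0, h2]
  · by_cases h1 : (a : ℕ) = 2 <;> simp [h0, h1, h2]

theorem sum_norm_cornerUnit_row {N : ℕ} (hN : 2 ≤ N) (a : Fin N) :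
    ∑ b, ‖cornerUnit N a b‖ = if (a : ℕ) = 0 then 1 else 0 := by
  obtain ⟨N, rfl⟩ := Nat.exists_eq_add_of_le' hN
  simp only [cornerUnit, Matrix.of_apply, Fin.sum_univ_succ]
  by_cases h0 : (a : ℕ) = 0 <;> simp [h0]

theorem sum_norm_cornerUnit_col {N : ℕ} (hN : 2 ≤ N) (a : Fin N) :
    ∑ b, ‖cornerUnit N b a‖ = if (a : ℕ) = 0 then 1 else 0 := by
  rw [← sum_norm_cornerUnit_row hN a]
  exact Finset.sum_congr rfl fun b _ => by
    rw [← Matrix.transpose_apply (cornerUnit N), cornerUnit_transpose]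

variable {m : ℕ} {n : Fin m → ℕ}

theorem prod_eq_mul_mul_prod_erase {j k : Fin m} (hjk : j ≠ k) (g : Fin m → ℝ) :
    ∏ l, g l = g j * (g k * ∏ l ∈ (Finset.univ.erase j).erase k, g l) := by
  rw [← Finset.mul_prod_erase _ _ (Finset.mem_univ j),
    ← Finset.mul_prod_erase _ _ (Finset.mem_erase.2 ⟨hjk.symm, Finset.mem_univ k⟩)]

/-- Transposing one shift turns the chain with weights 1, 4 into a chain with weights 2, 2 and
isolated edges of weights 4 and 1. Every row sum plus column sum is then at most 4, and the Schur
test gives 2. -/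
theorem numericalRadius_shift_transpose_le (hn : ∀ k, 2 ≤ n k) {j k : Fin m} (hjk : j ≠ k)
    (hj : 3 ≤ n j) (hk : 3 ≤ n k) {B : ∀ l, Matrix (Fin (n l)) (Fin (n l)) ℂ}
    (hBj : B j = (weightedShift (n j))ᵀ) (hBk : B k = weightedShift (n k))
    (hB : ∀ l, l ≠ j → l ≠ k → B l = cornerUnit (n l)) :
    numericalRadius (tensorMatrix B) ≤ 2 := by
  have : Nonempty (MultiIndex n) := ⟨fun k => ⟨0, by have := hn k; omega⟩⟩
  refine numericalRadius_le fun u hu => norm_quadForm_le (fun i => ?_) hu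
  rw [sum_norm_tensorMatrix_row, sum_norm_tensorMatrix_col, prod_eq_mul_mul_prod_erase hjk,
    prod_eq_mul_mul_prod_erase hjk, hBj, hBk]
  have hcol : ∏ l ∈ (Finset.univ.erase j).erase k, ∑ b, ‖B l b (i l)‖ =
      ∏ l ∈ (Finset.univ.erase j).erase k, if (i l : ℕ) = 0 then (1 : ℝ) else 0 :=
    Finset.prod_congr rfl fun l hl => by
      simp only [Finset.mem_erase, Finset.mem_univ, and_true] at hl
      rw [hB l hl.2 hl.1, sum_norm_cornerUnit_col (hn l)]
  have hrow : ∏ l ∈ (Finset.univ.erase j).erase k, ∑ b, ‖B l (i l) b‖ =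
      ∏ l ∈ (Finset.univ.erase j).erase k, if (i l : ℕ) = 0 then (1 : ℝ) else 0 :=
    Finset.prod_congr rfl fun l hl => by
      simp only [Finset.mem_erase, Finset.mem_univ, and_true] at hl
      rw [hB l hl.2 hl.1, sum_norm_cornerUnit_row (hn l)]
  rw [hcol, hrow, Finset.prod_ite_zero]
  simp only [Matrix.transpose_apply]
  rw [sum_norm_weightedShift_col hj, sum_norm_weightedShift_row hk, sum_norm_weightedShift_row hj,
    sum_norm_weightedShift_col hk]
  have h0 : ∀ x : ℕ, x = 0 ∨ x = 1 ∨ x = 2 ∨ (x ≠ 0 ∧ x ≠ 1 ∧ x ≠ 2) := fun x => by omega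
  rcases h0 (i j) with h | h | h | h <;> rcases h0 (i k) with h' | h' | h' | h' <;>
    simp only [h, h'] <;> split_ifs <;> norm_num

theorem lt_numericalRadius_shift (hn : ∀ k, 2 ≤ n k) {j k : Fin m} (hjk : j ≠ k)
    (hj : 3 ≤ n j) (hk : 3 ≤ n k) {A : ∀ l, Matrix (Fin (n l)) (Fin (n l)) ℂ}
    (hAj : A j = weightedShift (n j)) (hAk : A k = weightedShift (n k))
    (hA : ∀ l, l ≠ j → l ≠ k → A l = cornerUnit (n l)) :
    2 < numericalRadius (tensorMatrix A) := by
  let p : Fin 3 → MultiIndex n := fun t l =>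
    ⟨if l = j ∨ l = k then t else 0, by
      have := hn l
      have := t.is_lt
      split_ifs with h
      · rcases h with rfl | rfl <;> omega
      · omega⟩
  have hp : Function.Injective p := fun s t h => by
    have := congrArg Fin.val (congrFun h j)
    simp only [p, true_or, if_true] at this
    exact Fin.ext this
  have hentry : ∀ s t, tensorMatrix A (p s) (p t) =
      (if (s : ℕ) = 0 ∧ (t : ℕ) = 1 then 1 else if (s : ℕ) = 1 ∧ (t : ℕ) = 2 then 2 else 0) ^ 2 :=
    fun s t => by
      rw [tensorMatrix_apply, ← Finset.mul_prod_erase _ _ (Finset.mem_univ j),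
        ← Finset.mul_prod_erase _ _ (Finset.mem_erase.2 ⟨hjk.symm, Finset.mem_univ k⟩),
        Finset.prod_eq_one, hAj, hAk]
      · simp only [weightedShift, p, Matrix.of_apply, true_or, or_true, if_true, mul_one, sq]
      · intro l hl
        simp only [Finset.mem_erase, Finset.mem_univ, and_true] at hl
        rw [hA l hl.2 hl.1]
        simp [cornerUnit, p, hl.1, hl.2]
  -- On the span of the `p t` the product is the shift with weights 1, 4, of radius `√17 / 2`,
  -- attained along `(1, √17, 4)`. The integer approximation already gives `68 / 33 > 2`.
  let c : Fin 3 → ℂ := ![1, 4, 4]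
  let u : MultiIndex n → ℂ := ∑ t, c t • Pi.single (p t) 1
  have hu : star u = ∑ t, c t • Pi.single (p t) 1 := by
    simp [u, Fin.sum_univ_three, c]
  have hquad : star u ⬝ᵥ (tensorMatrix A *ᵥ u) = 68 := by
    rw [hu]
    simp only [u, Matrix.mulVec_sum, Matrix.mulVec_smul, sum_dotProduct, dotProduct_sum,
      smul_dotProduct, dotProduct_smul, Matrix.mulVec_single_one, single_dotProduct,
      Matrix.col_apply, hentry]
    simp [Fin.sum_univ_three, c]
    norm_num
  have hnorm : ∑ i, ‖u i‖ ^ 2 = 33 := by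
    have h : star u ⬝ᵥ u = 33 := by
      rw [hu]
      simp only [u, sum_dotProduct, dotProduct_sum, smul_dotProduct, dotProduct_smul,
        single_dotProduct, Pi.single_apply, hp.eq_iff]
      simp [Fin.sum_univ_three, c]
      norm_num
    rw [dotProduct_star_self_eq_sum] at h
    exact_mod_cast h
  have h := norm_quadForm_le_mul (fun v hv =>
    norm_quadForm_le_numericalRadius (tensorMatrix A) hv) u
  rw [hquad, hnorm] at h
  norm_num at h
  linarith

theorem not_numericalRadius_transposition (hn : ∀ k, 2 ≤ n k) {j k : Fin m}
    (hj : 3 ≤ n j) (hk : 3 ≤ n k)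
    {f : ∀ k : Fin m, Matrix (Fin (n k)) (Fin (n k)) ℂ → Matrix (Fin (n k)) (Fin (n k)) ℂ}
    (hf : ∀ k, f k = id ∨ f k = Matrix.transpose) (hfj : f j = Matrix.transpose) (hfk : f k = id)
    (hjk : j ≠ k)
    (h : ∀ A, numericalRadius (tensorMatrix fun k => f k (A k)) =
      numericalRadius (tensorMatrix A)) : False := by
  -- The corner units are symmetric, so the type of `f` on the other factors does not matter.
  let A : ∀ l, Matrix (Fin (n l)) (Fin (n l)) ℂ := fun l =>
    if l = j ∨ l = k then weightedShift (n l) else cornerUnit (n l)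
  have h1 : 2 < numericalRadius (tensorMatrix A) :=
    lt_numericalRadius_shift hn hjk hj hk (by simp [A]) (by simp [A])
      fun l hlj hlk => by simp [A, hlj, hlk]
  have h2 : numericalRadius (tensorMatrix fun l => f l (A l)) ≤ 2 :=
    numericalRadius_shift_transpose_le hn hjk hj hk (by simp [A, hfj]) (by simp [A, hfk])
      fun l hlj hlk => by
        rcases hf l with hl | hl <;> simp [A, hlj, hlk, hl, cornerUnit_transpose]
  rw [h] at h2
  linarith

end TypeObstruction

/-! ### The equivalence. -/

theorem theorem3p2 (m : ℕ) (hm : 1 ≤ m) (n : Fin m → ℕ) (hn : ∀ k, 2 ≤ n k)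
    (φ : Matrix (MultiIndex n) (MultiIndex n) ℂ →ₗ[ℂ] Matrix (MultiIndex n) (MultiIndex n) ℂ) :
    (∀ A : ∀ k : Fin m, Matrix (Fin (n k)) (Fin (n k)) ℂ,
        numericalRadius (φ (tensorMatrix A)) = numericalRadius (tensorMatrix A)) ↔
      ∃ U ∈ Matrix.unitaryGroup (MultiIndex n) ℂ, ∃ ξ : ℂ, ‖ξ‖ = 1 ∧
        ∃ f : ∀ k : Fin m, Matrix (Fin (n k)) (Fin (n k)) ℂ → Matrix (Fin (n k)) (Fin (n k)) ℂ,
          (∀ k, f k = id ∨ f k = Matrix.transpose) ∧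
          ((∀ k, 3 ≤ n k → f k = id) ∨ (∀ k, 3 ≤ n k → f k = Matrix.transpose)) ∧
          ∀ A : ∀ k : Fin m, Matrix (Fin (n k)) (Fin (n k)) ℂ,
            φ (tensorMatrix A) = ξ • (U * tensorMatrix (fun k => f k (A k)) * Uᴴ) := by
  constructor
  · intro h
    have hφ : PreservesRadius φ := h
    obtain ⟨U, hU, ξ, hξ, s, hs⟩ :=
      hφ.exists_partialTranspose_conj fun k => ⟨0, by have := hn k; omega⟩
    have hid : ∀ k, k ∉ s → transposeOn (n := n) s k = id := fun k hk => by
      funext X; simp [transposeOn, hk]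
    have htr : ∀ k, k ∈ s → transposeOn (n := n) s k = Matrix.transpose := fun k hk => by
      funext X; simp [transposeOn, hk]
    have hf : ∀ k, transposeOn (n := n) s k = id ∨ transposeOn (n := n) s k = Matrix.transpose :=
      fun k => by
        by_cases hk : k ∈ s
        · exact Or.inr (htr k hk)
        · exact Or.inl (hid k hk)
    refine ⟨U, hU, ξ, hξ, transposeOn s, hf, ?_, hs⟩
    by_contra hcon
    push Not at hcon
    obtain ⟨⟨j, hj, hfj⟩, k, hk, hfk⟩ := hcon
    have hjs : j ∈ s := by_contra fun hjs => hfj (hid j hjs)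
    have hks : k ∉ s := fun hks => hfk (htr k hks)
    refine not_numericalRadius_transposition hn hj hk hf (htr j hjs) (hid k hks)
      (fun hjk => hks (hjk ▸ hjs)) fun A => ?_
    rw [← h A, hs A, numericalRadius_smul hξ, numericalRadius_conj hU]
  · rintro ⟨U, hU, ξ, hξ, f, hf, hf3, h⟩ A
    rw [h, numericalRadius_smul hξ, numericalRadius_conj hU,
      numericalRadius_tensorMatrix_transposition hn hf hf3]
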